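/- Let $\mathbb X$ be a Polish space with its Borel $\sigma$-algebra, let $\mu$ be a non-atomic, locally finite measure on $\mathbb X$, and let $\eta$ be a Poisson point process on $\mathbb X$ with intensity measure $\mu$, regarded as a random simple locally finite point configuration. Let $k\ge 1$ and let $f:\mathbb X^k\to[0,\infty)$ be measurable, symmetric, and integrable with respect to $\mu^{k}$. For a point configuration $\eta$ let $\eta^k_{\neq}$ be the set of $k$-tuples of pairwise distinct points of $\eta$, and put $$U(f;\eta)=\sum_{(x_1,\dots,x_k)\in\eta^k_{\neq}} f(x_1,\dots,x_k),\qquad F(x;\eta)=\sum_{(x_1,\dots,x_{k-1})\in(\eta\setminus\{x\})^{k-1}_{\neq}} f(x,x_1,\dots,x_{k-1})\quad (x\in\eta).$$ Then the sum defining $U(f;\eta)$ converges almost surely. Let $m$ be a median of $U(f;\eta)$, that is, $\mathbb P(U(f;\eta)\le m)\ge\frac12$ and $\mathbb P(U(f;\eta)\ge m)\ge \frac12$, and assume that $B\in\mathbb R$ and $\varepsilon:\mathbb R\to\mathbb R$ satisfy $$\mathbb P\big(\exists\, x\in\eta:\ F(x;\eta)>B\big)\le\varepsilon(B).$$ Then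 for all $u\ge 0$, $$\mathbb P\big(|U(f;\eta)-m|\ge u\big)\le 4\exp\Big(-\frac{u^2}{4k^2B(u+m)}\Big)+3\,\varepsilon(B),$$ where the fraction is read as $0$ if its denominator vanishes. -/

import Mathlib

open MeasureTheory ProbabilityTheory Topology

/-- The space `N_s(X)` of simple locally finite point configurations on `X`: a simple locally finite
counting measure is identified with the set of its points. -/
def PointConfig (X : Type*) [TopologicalSpace X] : Type _ :=
  {s : Set X // ∀ x : X, ∃ V ∈ 𝓝 x, (V ∩ s).Finite}

namespace PointConfig

variable {X : Type*} [TopologicalSpace X]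

/-- The set of points of a configuration. -/
def points (η : PointConfig X) : Set X := η.1

/-- `η(A)`, the number of points of the configuration `η` in `A`. -/
noncomputable def count (A : Set X) (η : PointConfig X) : ℕ∞ := (η.points ∩ A).encard

/-- The σ-algebra on `N_s(X)` generated by the counting maps `η ↦ η(A)`, `A` measurable. -/
noncomputable instance instMeasurableSpace [MeasurableSpace X] : MeasurableSpace (PointConfig X) :=
  ⨆ (A : Set X) (_ : MeasurableSet A), MeasurableSpace.comap (count A) inferInstance

end PointConfig

/-- `η` is a Poisson point process with intensity measure `μ`, defined on the probability space
`(Ω, P)`: a random configuration such that `η(A)` is Poisson distributed with mean `μ(A)` and such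
that the numbers of points in pairwise disjoint measurable sets are independent. -/
structure IsPoissonProcess {X Ω : Type*} [TopologicalSpace X] [MeasurableSpace X]
    [MeasurableSpace Ω] (η : Ω → PointConfig X) (μ : Measure X) (P : Measure Ω) : Prop where
  measurable : Measurable η
  law_count : ∀ A : Set X, MeasurableSet A → μ A < ⊤ →
    HasLaw (fun ω => PointConfig.count A (η ω))
      ((poissonMeasure (μ A).toNNReal).map (Nat.cast : ℕ → ℕ∞)) P
  indep_count : ∀ (n : ℕ) (A : Fin n → Set X), (∀ i, MeasurableSet (A i)) →
    Pairwise (fun i j => Disjoint (A i) (A j)) →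
    iIndepFun (fun i ω => PointConfig.count (A i) (η ω)) P

/-- `s^k_≠`, the set of `k`-tuples of pairwise distinct points of `s`. -/
def distinctTuples {X : Type*} (k : ℕ) (s : Set X) : Set (Fin k → X) :=
  {x | Function.Injective x ∧ ∀ i, x i ∈ s}

/-- The U-statistic `U(f; s)`: the sum of `f` over all `k`-tuples of pairwise distinct points
of `s`. -/
noncomputable def uStatistic {X : Type*} {k : ℕ} (f : (Fin k → X) → ℝ) (s : Set X) : ℝ :=
  ∑' x : distinctTuples k s, f x

/-- The `k`-tuple `(x, y₁, …, y_{k-1})`. -/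
def consTuple {X : Type*} {k : ℕ} (x : X) (y : Fin (k - 1) → X) : Fin k → X :=
  fun i => if h : (i : ℕ) = 0 then x else y ⟨(i : ℕ) - 1, by omega⟩

/-- `F(x; s)`: the sum of `f(x, y₁, …, y_{k-1})` over all `(k-1)`-tuples of pairwise distinct points
of `s \ {x}`. -/
noncomputable def localStatistic {X : Type*} {k : ℕ} (f : (Fin k → X) → ℝ) (x : X) (s : Set X) :
    ℝ :=
  ∑' y : distinctTuples (k - 1) (s \ {x}), f (consTuple x y.1)

/-- `m` is a median of the random variable `Y`. -/
def IsMedian {Ω : Type*} [MeasurableSpace Ω] (Y : Ω → ℝ) (P : Measure Ω) (m : ℝ) : Prop :=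
  1 / 2 ≤ P.real {ω | Y ω ≤ m} ∧ 1 / 2 ≤ P.real {ω | m ≤ Y ω}

/-! The statistic `U` is self-bounding, which is what Talagrand's convex distance inequality
exploits. If a tuple of points of one configuration is missing from another, one of its points is
missing; so `U(z) - U(y)` is at most the sum of the influences of the points where `z` and `y`
differ, the influence of a point being the total weight of the tuples through it. By symmetry this
is at most `k * F`, and the influences sum to at most `k * U`. If `F ≤ B`, the squared influences
therefore sum to at most `k² * B * U(z)`. Normalising them to a unit vector shows that the set where
`b ≤ U` and `F ≤ B` lies at convex distance at least `(b - a) / √(k² B b)` from the set where `U ≤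
a`. Hence the product of the two probabilities is at most `exp (-(b - a)² / (4 k² B b))`. Choosing
`a, b` to be `m, m + u` and then `m - u, m` gives the two tails.

Talagrand's inequality is proved only for Bernoulli products
(`mass_mul_sum_exp_convexDistSq_le_one`), so the Poisson process is discretized. The space is cut
into finer and finer finite partitions; inside a set of finite measure the points eventually occupy
different cells, and the indicators of occupied cells are independent. The kernel is replaced by a
function of the cells (`exists_cellFunction_approx`). The `L¹` error of the kernel controls the
expected error of the sum through a factorial moment bound (`lintegral_lintegral_tupleMeasure_le`).
Letting the error tend to zero transfers the two-set bound (`uStatistic_concentration`). -/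

/-! ### Talagrand's convex distance inequality on the discrete cube -/

namespace DiscreteCube

/-- The vector marking the coordinates in which `x` and `y` differ. -/
def mismatch {n : ℕ} (x y : Fin n → Bool) : Fin n → ℝ := fun i => if x i = y i then 0 else 1

/-- The convex hull of the mismatch vectors between `x` and the points of `A`. -/
def mismatchHull {n : ℕ} (A : Set (Fin n → Bool)) (x : Fin n → Bool) : Set (Fin n → ℝ) :=
  convexHull ℝ (mismatch x '' A)

/-- The square of Talagrand's convex distance from `x` to `A`. -/
noncomputable def convexDistSq {n : ℕ} (A : Set (Fin n → Bool)) (x : Fin n → Bool) : ℝ :=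
  sInf ((fun v : Fin n → ℝ => ∑ i, v i ^ 2) '' mismatchHull A x)

/-- The mass of `x` under the product of the Bernoulli laws with parameters `p i`. -/
def weight {n : ℕ} (p : Fin n → ℝ) (x : Fin n → Bool) : ℝ := ∏ i, if x i then p i else 1 - p i

open Classical in
/-- The mass of the set `A` under the product of the Bernoulli laws with parameters `p i`. -/
noncomputable def mass {n : ℕ} (p : Fin n → ℝ) (A : Set (Fin n → Bool)) : ℝ :=
  ∑ x, if x ∈ A then weight p x else 0

variable {n : ℕ}

lemma weight_nonneg {p : Fin n → ℝ} (h0 : ∀ i, 0 ≤ p i) (h1 : ∀ i, p i ≤ 1) (x : Fin n → Bool) :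
    0 ≤ weight p x := by
  refine Finset.prod_nonneg fun i _ => ?_
  split_ifs
  · exact h0 i
  · linarith [h1 i]

lemma sum_cons {M : Type*} [AddCommMonoid M] (g : (Fin (n + 1) → Bool) → M) :
    ∑ x, g x = ∑ b : Bool, ∑ x : Fin n → Bool, g (Fin.cons b x) := by
  rw [← Fintype.sum_prod_type']
  exact (Fintype.sum_equiv (Fin.consEquiv (fun _ : Fin (n + 1) => Bool)) _ _ fun x => rfl).symm

lemma weight_cons (p : Fin (n + 1) → ℝ) (b : Bool) (x : Fin n → Bool) :
    weight p (Fin.cons b x : Fin (n + 1) → Bool) =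
      (if b then p 0 else 1 - p 0) * weight (fun i => p i.succ) x := by
  simp [weight, Fin.prod_univ_succ]

lemma mass_mono {p : Fin n → ℝ} (h0 : ∀ i, 0 ≤ p i) (h1 : ∀ i, p i ≤ 1)
    {A B : Set (Fin n → Bool)} (h : A ⊆ B) : mass p A ≤ mass p B := by
  refine Finset.sum_le_sum fun x _ => ?_
  have := weight_nonneg h0 h1 x
  by_cases hx : x ∈ A
  · simp [hx, h hx]
  · simp only [hx, if_false]; split_ifs <;> simp [this]

lemma mass_nonneg {p : Fin n → ℝ} (h0 : ∀ i, 0 ≤ p i) (h1 : ∀ i, p i ≤ 1)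
    (A : Set (Fin n → Bool)) : 0 ≤ mass p A := by
  refine Finset.sum_nonneg fun x _ => ?_
  split_ifs
  exacts [weight_nonneg h0 h1 x, le_rfl]

lemma mass_cons (p : Fin (n + 1) → ℝ) (A : Set (Fin (n + 1) → Bool)) :
    mass p A = p 0 * mass (fun i => p i.succ) {x | (Fin.cons true x : Fin (n + 1) → Bool) ∈ A} +
      (1 - p 0) * mass (fun i => p i.succ) {x | (Fin.cons false x : Fin (n + 1) → Bool) ∈ A} := by
  simp [mass, sum_cons, weight_cons, Finset.mul_sum]

lemma convexDistSq_le {A : Set (Fin n → Bool)} {x : Fin n → Bool} {v : Fin n → ℝ}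
    (hv : v ∈ mismatchHull A x) : convexDistSq A x ≤ ∑ i, v i ^ 2 :=
  csInf_le ⟨0, by rintro _ ⟨v, -, rfl⟩; exact Finset.sum_nonneg fun i _ => sq_nonneg _⟩ ⟨v, hv, rfl⟩

lemma mismatchHull_nonempty {A : Set (Fin n → Bool)} (hA : A.Nonempty) (x : Fin n → Bool) :
    (mismatchHull A x).Nonempty :=
  (hA.image _).mono (subset_convexHull ℝ _)

lemma exists_lt_convexDistSq_add {A : Set (Fin n → Bool)} (hA : A.Nonempty) (x : Fin n → Bool)
    {e : ℝ} (he : 0 < e) : ∃ v ∈ mismatchHull A x, ∑ i, v i ^ 2 < convexDistSq A x + e := by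
  obtain ⟨_, ⟨v, hv, rfl⟩, h⟩ :=
    Real.lt_sInf_add_pos ((mismatchHull_nonempty hA x).image fun v : Fin n → ℝ => ∑ i, v i ^ 2) he
  exact ⟨v, hv, h⟩

/-- Duality: a linear functional that is at least `s` on the mismatch vectors is at least `s` on
their hull, and Cauchy–Schwarz turns this into a lower bound for the norm. This is how convex
distances are bounded from below later. -/
lemma sq_le_convexDistSq {A : Set (Fin n → Bool)} (hA : A.Nonempty) {x : Fin n → Bool}
    {a : Fin n → ℝ} (ha : ∑ i, a i ^ 2 ≤ 1) {s : ℝ} (hs : 0 ≤ s)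
    (h : ∀ y ∈ A, s ≤ ∑ i, a i * mismatch x y i) : s ^ 2 ≤ convexDistSq A x := by
  refine le_csInf ((mismatchHull_nonempty hA x).image _) ?_
  rintro _ ⟨v, hv, rfl⟩
  have hconv : Convex ℝ {v : Fin n → ℝ | s ≤ ∑ i, a i * v i} := by
    intro u hu w hw c d hc hd hcd
    simp only [Set.mem_ofPred_eq, Pi.add_apply, Pi.smul_apply, smul_eq_mul, mul_add] at hu hw ⊢
    have : ∑ i, (a i * (c * u i) + a i * (d * w i)) =
        c * ∑ i, a i * u i + d * ∑ i, a i * w i := by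
      rw [Finset.sum_add_distrib, Finset.mul_sum, Finset.mul_sum]
      congr 1 <;> exact Finset.sum_congr rfl fun i _ => by ring
    rw [this]
    calc s = c * s + d * s := by rw [← add_mul, hcd, one_mul]
      _ ≤ _ := by gcongr
  have hsv : s ≤ ∑ i, a i * v i := by
    refine convexHull_min ?_ hconv hv
    rintro _ ⟨y, hy, rfl⟩
    exact h y hy
  have hcs := Finset.sum_mul_sq_le_sq_mul_sq Finset.univ a v
  have hv0 : 0 ≤ ∑ i, v i ^ 2 := Finset.sum_nonneg fun i _ => sq_nonneg _
  calc s ^ 2 ≤ (∑ i, a i * v i) ^ 2 := by gcongr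
    _ ≤ _ := hcs
    _ ≤ 1 * ∑ i, v i ^ 2 := by gcongr
    _ = _ := one_mul _

lemma mismatch_cons_same (b : Bool) (x y : Fin n → Bool) :
    mismatch (Fin.cons b x : Fin (n + 1) → Bool) (Fin.cons b y : Fin (n + 1) → Bool) =
      (Fin.cons 0 (mismatch x y) : Fin (n + 1) → ℝ) := by
  ext i; refine Fin.cases ?_ (fun i => ?_) i <;> simp [mismatch]

lemma cons_mem_mismatchHull {A : Set (Fin (n + 1) → Bool)} {b : Bool} {x : Fin n → Bool}
    {v : Fin n → ℝ} (hv : v ∈ mismatchHull {y | (Fin.cons b y : Fin (n + 1) → Bool) ∈ A} x) :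
    (Fin.cons 0 v : Fin (n + 1) → ℝ) ∈ mismatchHull A (Fin.cons b x : Fin (n + 1) → Bool) := by
  have hconv : Convex ℝ {v : Fin n → ℝ |
      (Fin.cons 0 v : Fin (n + 1) → ℝ) ∈ mismatchHull A (Fin.cons b x : Fin (n + 1) → Bool)} := by
    intro u hu w hw c d hc hd hcd
    have := convex_convexHull ℝ _ hu hw hc hd hcd
    rw [Set.mem_ofPred_eq]
    convert! this using 1
    ext i; refine Fin.cases ?_ (fun i => ?_) i <;> simp
  refine convexHull_min ?_ hconv hv
  rintro _ ⟨y, hy, rfl⟩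
  rw [Set.mem_ofPred_eq, ← mismatch_cons_same]
  exact subset_convexHull ℝ _ ⟨_, hy, rfl⟩

/-- The points of the projection of `A` may lift with either first coordinate, so all that is known
of the new entry `t` is that it averages zeros and ones. -/
lemma exists_cons_mem_mismatchHull {A : Set (Fin (n + 1) → Bool)} (b : Bool) {x : Fin n → Bool}
    {w : Fin n → ℝ} (hw : w ∈ mismatchHull {y | ∃ c, (Fin.cons c y : Fin (n + 1) → Bool) ∈ A} x) :
    ∃ t : ℝ, 0 ≤ t ∧ t ≤ 1 ∧ (Fin.cons t w : Fin (n + 1) → ℝ) ∈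
      mismatchHull A (Fin.cons b x : Fin (n + 1) → Bool) := by
  have hconv : Convex ℝ {w : Fin n → ℝ | ∃ t : ℝ, 0 ≤ t ∧ t ≤ 1 ∧
      (Fin.cons t w : Fin (n + 1) → ℝ) ∈ mismatchHull A (Fin.cons b x : Fin (n + 1) → Bool)} := by
    rintro u ⟨t, ht0, ht1, hu⟩ w ⟨r, hr0, hr1, hw⟩ c d hc hd hcd
    have := convex_convexHull ℝ _ hu hw hc hd hcd
    refine ⟨c * t + d * r, by positivity, ?_, ?_⟩
    · calc c * t + d * r ≤ c * 1 + d * 1 := by gcongr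
        _ = 1 := by rw [mul_one, mul_one, hcd]
    · convert! this using 1
      ext i; refine Fin.cases ?_ (fun i => ?_) i <;> simp
  refine convexHull_min ?_ hconv hw
  rintro _ ⟨y, ⟨c, hc⟩, rfl⟩
  refine ⟨if b = c then 0 else 1, by split_ifs <;> simp, by split_ifs <;> simp,
    subset_convexHull ℝ _ ⟨_, hc, ?_⟩⟩
  ext i; refine Fin.cases ?_ (fun i => ?_) i <;> simp [mismatch]

lemma convexDistSq_cons_le_one_add {A : Set (Fin (n + 1) → Bool)} (hA : A.Nonempty) (b : Bool)
    (x : Fin n → Bool) : convexDistSq A (Fin.cons b x : Fin (n + 1) → Bool) ≤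
      1 + convexDistSq {y | ∃ c, (Fin.cons c y : Fin (n + 1) → Bool) ∈ A} x := by
  have hB : {y | ∃ c, (Fin.cons c y : Fin (n + 1) → Bool) ∈ A}.Nonempty := by
    obtain ⟨y, hy⟩ := hA
    exact ⟨Fin.tail y, y 0, by simpa using hy⟩
  refine le_of_forall_pos_le_add fun e he => ?_
  obtain ⟨w, hw, hwe⟩ := exists_lt_convexDistSq_add hB x he
  obtain ⟨t, ht0, ht1, h⟩ := exists_cons_mem_mismatchHull b hw
  have h := convexDistSq_le h
  simp only [Fin.sum_univ_succ, Fin.cons_zero, Fin.cons_succ] at h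
  have : t ^ 2 ≤ 1 := by nlinarith
  linarith

/-- Mix a near-optimal vector of the section, which costs nothing in the first coordinate, with one
of the projection, which costs at most `1` there; then use convexity of the square. -/
lemma convexDistSq_cons_le {A : Set (Fin (n + 1) → Bool)} {b : Bool}
    (hAb : {y | (Fin.cons b y : Fin (n + 1) → Bool) ∈ A}.Nonempty)
    (x : Fin n → Bool) {l : ℝ} (hl0 : 0 ≤ l) (hl1 : l ≤ 1) :
    convexDistSq A (Fin.cons b x : Fin (n + 1) → Bool) ≤ (1 - l) ^ 2 +
      (l * convexDistSq {y | (Fin.cons b y : Fin (n + 1) → Bool) ∈ A} x +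
      (1 - l) * convexDistSq {y | ∃ c, (Fin.cons c y : Fin (n + 1) → Bool) ∈ A} x) := by
  have hB : {y | ∃ c, (Fin.cons c y : Fin (n + 1) → Bool) ∈ A}.Nonempty :=
    hAb.mono fun y hy => ⟨b, hy⟩
  refine le_of_forall_pos_le_add fun e he => ?_
  obtain ⟨v, hv, hve⟩ := exists_lt_convexDistSq_add hAb x he
  obtain ⟨w, hw, hwe⟩ := exists_lt_convexDistSq_add hB x he
  obtain ⟨t, ht0, ht1, h⟩ := exists_cons_mem_mismatchHull b hw
  have hl1' : 0 ≤ 1 - l := by linarith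
  have h := convexDistSq_le (convex_convexHull ℝ _ (cons_mem_mismatchHull hv) h hl0 hl1' (by ring))
  simp only [Fin.sum_univ_succ, Fin.cons_zero, Fin.cons_succ, Pi.add_apply, Pi.smul_apply,
    smul_eq_mul, mul_zero, zero_add] at h
  have h1 : ∑ i, (l * v i + (1 - l) * w i) ^ 2 ≤ l * ∑ i, v i ^ 2 + (1 - l) * ∑ i, w i ^ 2 := by
    rw [Finset.mul_sum, Finset.mul_sum, ← Finset.sum_add_distrib]
    refine Finset.sum_le_sum fun i _ => ?_
    nlinarith [mul_nonneg (mul_nonneg hl0 hl1') (sq_nonneg (v i - w i))]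
  have h2 : ((1 - l) * t) ^ 2 ≤ (1 - l) ^ 2 := by
    have : t ^ 2 ≤ 1 := by nlinarith
    nlinarith [sq_nonneg (1 - l)]
  nlinarith [mul_le_mul_of_nonneg_left hve.le hl0, mul_le_mul_of_nonneg_left hwe.le hl1']

/-- Factoring out `exp (-L² / 2)` leaves `2 * cosh (L - L² / 2)`, and `cosh x ≤ exp (x² / 2)` with
`L - L² / 2 ≤ L`. -/
lemma exp_sub_sq_add_exp_neg_le {L : ℝ} (h0 : 0 ≤ L) (h1 : L ≤ 1 / 2) :
    Real.exp (L - L ^ 2) + Real.exp (-L) ≤ 2 := by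
  have h := Real.cosh_le_exp_half_sq (L - L ^ 2 / 2)
  have h2 : Real.exp (L - L ^ 2) + Real.exp (-L) =
      2 * (Real.exp (-(L ^ 2 / 2)) * Real.cosh (L - L ^ 2 / 2)) := by
    rw [Real.cosh_eq, mul_div_assoc', mul_div_cancel₀ _ two_ne_zero, mul_add, ← Real.exp_add,
      ← Real.exp_add]
    ring_nf
  have h3 : (L - L ^ 2 / 2) ^ 2 ≤ L ^ 2 := by
    have : 0 ≤ L - L ^ 2 / 2 := by nlinarith
    have : L - L ^ 2 / 2 ≤ L := by nlinarith
    gcongr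
  have h4 : Real.exp (-(L ^ 2 / 2)) * Real.cosh (L - L ^ 2 / 2) ≤ 1 := by
    calc _ ≤ Real.exp (-(L ^ 2 / 2)) * Real.exp ((L - L ^ 2 / 2) ^ 2 / 2) := by gcongr
      _ = Real.exp (((L - L ^ 2 / 2) ^ 2 - L ^ 2) / 2) := by rw [← Real.exp_add]; ring_nf
      _ ≤ 1 := Real.exp_le_one_iff.2 (by linarith)
  linarith

lemma exp_quarter_add_exp_neg_half_le : Real.exp (1 / 4) + Real.exp (-(1 / 2)) ≤ 2 := by
  have := exp_sub_sq_add_exp_neg_le (L := 1 / 2) (by norm_num) le_rfl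
  norm_num at this ⊢
  exact this

/-- The induction step for one value `b` of the first coordinate. -/
lemma mass_mul_sum_cons_le {p : Fin n → ℝ} (h0 : ∀ i, 0 ≤ p i) (h1 : ∀ i, p i ≤ 1)
    (ih : ∀ A : Set (Fin n → Bool), A.Nonempty →
      mass p A * ∑ x, weight p x * Real.exp (convexDistSq A x / 4) ≤ 1)
    {A : Set (Fin (n + 1) → Bool)} (hA : A.Nonempty) (b : Bool)
    (hB : 0 < mass p {y | ∃ c, (Fin.cons c y : Fin (n + 1) → Bool) ∈ A}) :
    mass p {y | ∃ c, (Fin.cons c y : Fin (n + 1) → Bool) ∈ A} *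
      ∑ x, weight p x * Real.exp (convexDistSq A (Fin.cons b x : Fin (n + 1) → Bool) / 4) ≤
    2 - mass p {y | (Fin.cons b y : Fin (n + 1) → Bool) ∈ A} /
      mass p {y | ∃ c, (Fin.cons c y : Fin (n + 1) → Bool) ∈ A} := by
  set B := {y | ∃ c, (Fin.cons c y : Fin (n + 1) → Bool) ∈ A} with hBdef
  set Ab := {y | (Fin.cons b y : Fin (n + 1) → Bool) ∈ A} with hAbdef
  have hBne : B.Nonempty := by
    obtain ⟨y, hy⟩ := hA
    exact ⟨Fin.tail y, y 0, by simpa using hy⟩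
  set r := mass p Ab / mass p B with hr
  have hr1 : r ≤ 1 := (div_le_one hB).2 (mass_mono h0 h1 fun y hy => ⟨b, hy⟩)
  -- The threshold is where the optimal weight `1 + 2 * log r` changes sign; below it the section is
  -- too small to help and only the projection is used.
  rcases le_or_gt r (Real.exp (-(1 / 2))) with hre | hre
  · calc _ ≤ mass p B * ∑ x, weight p x * (Real.exp (1 / 4) * Real.exp (convexDistSq B x / 4)) := by
          have := hB.le
          refine mul_le_mul_of_nonneg_left (Finset.sum_le_sum fun x _ =>
            mul_le_mul_of_nonneg_left ?_ (weight_nonneg h0 h1 x)) this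
          rw [← Real.exp_add, Real.exp_le_exp]
          have := convexDistSq_cons_le_one_add hA b x
          linarith
      _ = Real.exp (1 / 4) * (mass p B * ∑ x, weight p x * Real.exp (convexDistSq B x / 4)) := by
          rw [mul_left_comm, Finset.mul_sum Finset.univ _ (Real.exp _)]
          congr 1
          exact Finset.sum_congr rfl fun x _ => by ring
      _ ≤ Real.exp (1 / 4) * 1 := by gcongr; exact ih B hBne
      _ ≤ 2 - r := by linarith [exp_quarter_add_exp_neg_half_le]
  · have hr0 : 0 < r := (Real.exp_pos _).trans hre
    have hAb0 : 0 < mass p Ab := by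
      rcases (mass_nonneg h0 h1 Ab).eq_or_lt with h | h
      · rw [hr, ← h, zero_div] at hr0
        exact absurd hr0 (lt_irrefl _)
      · exact h
    have hAbne : Ab.Nonempty := by
      by_contra hne
      rw [Set.not_nonempty_iff_eq_empty] at hne
      simp [hne, mass] at hAb0
    have hlr : -(1 / 2) < Real.log r := (Real.lt_log_iff_exp_lt hr0).2 hre
    have hlr0 : Real.log r ≤ 0 := Real.log_nonpos hr0.le hr1
    -- This weight minimizes `(1 - l)² / 4 - l * log r`.
    set l := 1 + 2 * Real.log r with hl
    have hl0 : 0 ≤ l := by linarith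
    have hl1 : l ≤ 1 := by linarith
    have hl1' : 0 ≤ 1 - l := by linarith
    have hlog : Real.log r = Real.log (mass p Ab) - Real.log (mass p B) :=
      Real.log_div hAb0.ne' hB.ne'
    -- Convexity of `exp` replaces Hölder's inequality: with the masses placed inside the exponents,
    -- both summands on the right are at most `1` after summation, by induction.
    have key : ∀ x, mass p B * Real.exp (convexDistSq A (Fin.cons b x : Fin (n + 1) → Bool) / 4) ≤
        Real.exp ((1 - l) ^ 2 / 4 - l * Real.log r) *
          (l * (mass p Ab * Real.exp (convexDistSq Ab x / 4)) +
            (1 - l) * (mass p B * Real.exp (convexDistSq B x / 4))) := by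
      intro x
      have hd := convexDistSq_cons_le hAbne x hl0 hl1
      rw [← hBdef, ← hAbdef] at hd
      have hc := convexOn_exp.2 (Set.mem_univ (Real.log (mass p Ab) + convexDistSq Ab x / 4))
        (Set.mem_univ (Real.log (mass p B) + convexDistSq B x / 4)) hl0 hl1' (by ring)
      simp only [smul_eq_mul, Real.exp_add (Real.log _), Real.exp_log hAb0, Real.exp_log hB] at hc
      calc _ = Real.exp (Real.log (mass p B) +
            convexDistSq A (Fin.cons b x : Fin (n + 1) → Bool) / 4) := by
            rw [Real.exp_add, Real.exp_log hB]
        _ ≤ Real.exp (((1 - l) ^ 2 / 4 - l * Real.log r) +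
            (l * (Real.log (mass p Ab) + convexDistSq Ab x / 4) +
              (1 - l) * (Real.log (mass p B) + convexDistSq B x / 4))) := by
            rw [Real.exp_le_exp, hlog]
            nlinarith
        _ ≤ _ := by rw [Real.exp_add]; gcongr
    calc _ = ∑ x, weight p x *
          (mass p B * Real.exp (convexDistSq A (Fin.cons b x : Fin (n + 1) → Bool) / 4)) := by
          rw [Finset.mul_sum]; exact Finset.sum_congr rfl fun x _ => by ring
      _ ≤ ∑ x, weight p x * (Real.exp ((1 - l) ^ 2 / 4 - l * Real.log r) *
          (l * (mass p Ab * Real.exp (convexDistSq Ab x / 4)) +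
            (1 - l) * (mass p B * Real.exp (convexDistSq B x / 4)))) :=
          Finset.sum_le_sum fun x _ => mul_le_mul_of_nonneg_left (key x) (weight_nonneg h0 h1 x)
      _ = Real.exp ((1 - l) ^ 2 / 4 - l * Real.log r) *
          (l * (mass p Ab * ∑ x, weight p x * Real.exp (convexDistSq Ab x / 4)) +
            (1 - l) * (mass p B * ∑ x, weight p x * Real.exp (convexDistSq B x / 4))) := by
          simp only [Finset.mul_sum, ← Finset.sum_add_distrib]
          exact Finset.sum_congr rfl fun x _ => by ring
      _ ≤ Real.exp ((1 - l) ^ 2 / 4 - l * Real.log r) * (l * 1 + (1 - l) * 1) := by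
          have := ih Ab hAbne
          have := ih B hBne
          gcongr
      _ = Real.exp (-Real.log r - (-Real.log r) ^ 2) := by
          rw [mul_one, mul_one, add_sub_cancel, mul_one]
          congr 1
          rw [hl]; ring
      _ ≤ 2 - r := by
          have := exp_sub_sq_add_exp_neg_le (L := -Real.log r) (by linarith) (by linarith)
          rw [neg_neg, Real.exp_log hr0] at this
          linarith

/-- **Talagrand's convex distance inequality** for a product of Bernoulli laws. -/
theorem mass_mul_sum_exp_convexDistSq_le_one : ∀ {n : ℕ} {p : Fin n → ℝ}, (∀ i, 0 ≤ p i) →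
    (∀ i, p i ≤ 1) → ∀ A : Set (Fin n → Bool), A.Nonempty →
      mass p A * ∑ x, weight p x * Real.exp (convexDistSq A x / 4) ≤ 1 := by
  intro n
  induction n with
  | zero =>
    intro p h0 h1 A hA
    have hd : ∀ x, convexDistSq A x ≤ 0 := fun x => by
      obtain ⟨v, hv⟩ := mismatchHull_nonempty hA x
      simpa using convexDistSq_le hv
    obtain ⟨y, hy⟩ := hA
    have hm : mass p A = 1 := by
      have : ∀ x, x ∈ A := fun x => Subsingleton.elim y x ▸ hy
      simp [mass, weight, this]
    rw [hm, one_mul]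
    rw [Fintype.sum_unique]
    simp only [weight, Finset.univ_eq_empty, Finset.prod_empty, one_mul]
    exact Real.exp_le_one_iff.2 (div_nonpos_of_nonpos_of_nonneg (hd _) (by norm_num))
  | succ n ih =>
    intro p h0 h1 A hA
    set q : Fin n → ℝ := fun i => p i.succ with hq
    have hq0 : ∀ i, 0 ≤ q i := fun i => h0 _
    have hq1 : ∀ i, q i ≤ 1 := fun i => h1 _
    have hp0 := h0 0
    have hp1 : 0 ≤ 1 - p 0 := by linarith [h1 0]
    set B := {y | ∃ c, (Fin.cons c y : Fin (n + 1) → Bool) ∈ A} with hBdef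
    set E : Bool → ℝ := fun b =>
      ∑ x, weight q x * Real.exp (convexDistSq A (Fin.cons b x : Fin (n + 1) → Bool) / 4)
    have hE : ∑ x, weight p x * Real.exp (convexDistSq A x / 4) =
        p 0 * E true + (1 - p 0) * E false := by
      simp [sum_cons, weight_cons, E, Finset.mul_sum, mul_assoc, hq]
    have hm := mass_cons p A
    have hmt : mass q {x | (Fin.cons true x : Fin (n + 1) → Bool) ∈ A} ≤ mass q B :=
      mass_mono hq0 hq1 fun y hy => ⟨_, hy⟩
    have hmf : mass q {x | (Fin.cons false x : Fin (n + 1) → Bool) ∈ A} ≤ mass q B :=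
      mass_mono hq0 hq1 fun y hy => ⟨_, hy⟩
    rw [← hq] at hm
    -- If the projection is null, the ratios below are meaningless, but then `A` itself is null.
    rcases (mass_nonneg hq0 hq1 B).eq_or_lt with hB | hB
    · have h2 := mass_nonneg hq0 hq1 {x | (Fin.cons true x : Fin (n + 1) → Bool) ∈ A}
      have h3 := mass_nonneg hq0 hq1 {x | (Fin.cons false x : Fin (n + 1) → Bool) ∈ A}
      rw [hm, le_antisymm (hmt.trans hB.ge) h2, le_antisymm (hmf.trans hB.ge) h3]
      simp
    · have ht := mass_mul_sum_cons_le hq0 hq1 (ih hq0 hq1) hA true hB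
      have hf := mass_mul_sum_cons_le hq0 hq1 (ih hq0 hq1) hA false hB
      set t := mass p A / mass q B with htdef
      have hsum : mass q B * (p 0 * E true + (1 - p 0) * E false) ≤ 2 - t := by
        calc _ = p 0 * (mass q B * E true) + (1 - p 0) * (mass q B * E false) := by ring
          _ ≤ p 0 * (2 - mass q {y | (Fin.cons true y : Fin (n + 1) → Bool) ∈ A} / mass q B) +
              (1 - p 0) * (2 - mass q {y | (Fin.cons false y : Fin (n + 1) → Bool) ∈ A} /
                mass q B) := by gcongr
          _ = 2 - t := by rw [htdef, hm]; field_simp; ring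
      have ht0 : 0 ≤ t := div_nonneg (mass_nonneg h0 h1 A) hB.le
      have hmt : mass p A = t * mass q B := by rw [htdef]; field_simp
      rw [hE, hmt, mul_assoc]
      -- The product is at most `t * (2 - t)`, hence at most `1`.
      nlinarith [mul_le_mul_of_nonneg_left hsum ht0, sq_nonneg (t - 1)]

/-- Talagrand's inequality for two sets, one of which is far from the other. -/
theorem mass_mul_mass_le {p : Fin n → ℝ} (h0 : ∀ i, 0 ≤ p i) (h1 : ∀ i, p i ≤ 1)
    {A S : Set (Fin n → Bool)} {s : ℝ} (hs : 0 ≤ s)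
    (h : ∀ z ∈ S, ∃ a : Fin n → ℝ, ∑ i, a i ^ 2 ≤ 1 ∧
      ∀ y ∈ A, s ≤ ∑ i, a i * mismatch z y i) :
    mass p A * mass p S ≤ Real.exp (-(s ^ 2 / 4)) := by
  rcases A.eq_empty_or_nonempty with rfl | hA
  · simp only [mass, Set.mem_empty_iff_false, if_false, Finset.sum_const_zero, zero_mul]
    positivity
  have hT := mass_mul_sum_exp_convexDistSq_le_one h0 h1 A hA
  -- Markov's inequality for the exponential of the squared distance.
  have hS : mass p S * Real.exp (s ^ 2 / 4) ≤
      ∑ x, weight p x * Real.exp (convexDistSq A x / 4) := by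
    rw [mass, Finset.sum_mul]
    refine Finset.sum_le_sum fun x _ => ?_
    have hw := weight_nonneg h0 h1 x
    split_ifs with hx
    · obtain ⟨a, ha, hay⟩ := h x hx
      have := sq_le_convexDistSq hA ha hs hay
      gcongr
    · rw [zero_mul]; positivity
  rw [Real.exp_neg, ← one_div, le_div_iff₀ (Real.exp_pos _), mul_assoc]
  exact (mul_le_mul_of_nonneg_left hS (mass_nonneg h0 h1 A)).trans hT

end DiscreteCube

/-! ### Cells, and the counting measure on tuples of distinct points -/

namespace PointConfig

lemma countable_points {X : Type*} [TopologicalSpace X] [SecondCountableTopology X]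
    (η : PointConfig X) : η.points.Countable := by
  choose V hV hfin using η.2
  obtain ⟨s, hs, hcov⟩ := TopologicalSpace.countable_cover_nhds hV
  have : η.points ⊆ ⋃ x ∈ s, V x ∩ η.1 := by
    intro y hy
    have : y ∈ ⋃ x ∈ s, V x := hcov ▸ Set.mem_univ y
    simp only [Set.mem_iUnion] at this ⊢
    obtain ⟨x, hx, hyx⟩ := this
    exact ⟨x, hx, hyx, hy⟩
  exact (hs.biUnion fun x _ => (hfin x).countable).mono this

lemma measurable_count {X : Type*} [TopologicalSpace X] [MeasurableSpace X] {A : Set X}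
    (hA : MeasurableSet A) : Measurable (count A : PointConfig X → ℕ∞) :=
  Measurable.of_comap_le (le_iSup₂_of_le A hA le_rfl)

end PointConfig

section Cells

variable (X : Type*) [MeasurableSpace X] [MeasurableSpace.CountablyGenerated X]

/-- The index of the cell of `x` in the `n`-th partition of a refining sequence of finite
measurable partitions generating the σ-algebra. -/
noncomputable def cell (n : ℕ) (x : X) : Fin n → Bool :=
  fun i => MeasurableSpace.mapNatBool X x i

variable {X}

lemma measurable_cell (n : ℕ) : Measurable (cell X n) :=
  measurable_pi_iff.2 fun i =>
    (measurable_pi_apply (i : ℕ)).comp (MeasurableSpace.measurable_mapNatBool X)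

lemma cell_eq_of_le {m n : ℕ} (h : m ≤ n) {x y : X} (hxy : cell X n x = cell X n y) :
    cell X m x = cell X m y :=
  funext fun i => congrFun hxy (Fin.castLE h i)

lemma exists_cell_ne [MeasurableSpace.SeparatesPoints X] {x y : X} (h : x ≠ y) :
    ∃ n, cell X n x ≠ cell X n y := by
  by_contra! hc
  refine h (MeasurableSpace.injective_mapNatBool X (funext fun i => ?_))
  exact congrFun (hc (i + 1)) (Fin.last i)

lemma cell_ne_of_le {m n : ℕ} (h : m ≤ n) {x y : X} (hxy : cell X m x ≠ cell X m y) :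
    cell X n x ≠ cell X n y :=
  fun h' => hxy (cell_eq_of_le h h')

/-- Finitely many points eventually lie in different cells. -/
lemma exists_injOn_cell [MeasurableSpace.SeparatesPoints X] {s : Set X} (hs : s.Finite) :
    ∃ n, ∀ m, n ≤ m → Set.InjOn (cell X m) s := by
  have : ∀ p : X × X, ∃ n, p.1 ≠ p.2 → cell X n p.1 ≠ cell X n p.2 := by
    intro p
    by_cases h : p.1 = p.2
    · exact ⟨0, fun h' => absurd h h'⟩
    · obtain ⟨n, hn⟩ := exists_cell_ne h
      exact ⟨n, fun _ => hn⟩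
  choose N hN using this
  refine ⟨(hs.prod hs).toFinset.sup N, fun m hm x hx y hy hxy => ?_⟩
  by_contra h
  refine cell_ne_of_le (le_trans ?_ hm) (hN (x, y) h) hxy
  exact Finset.le_sup (f := N) (by simp [hx, hy])

lemma measurableSet_cell_fiber (n : ℕ) (c : Fin n → Bool) :
    MeasurableSet (cell X n ⁻¹' {c}) :=
  measurable_cell n (measurableSet_singleton c)

end Cells

section TupleMeasure

lemma Set.Countable.distinctTuples {X : Type*} {s : Set X} (hs : s.Countable) (k : ℕ) :
    (distinctTuples k s).Countable :=
  (Set.countable_pi (fun _ : Fin k => hs)).mono fun _ hx => hx.2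

variable {X : Type*} [MeasurableSpace X]

/-- The counting measure on the `k`-tuples of pairwise distinct points of `s`. -/
noncomputable def tupleMeasure (k : ℕ) (s : Set X) : Measure (Fin k → X) :=
  Measure.count.restrict (distinctTuples k s)

variable [MeasurableSingletonClass X]

lemma lintegral_tupleMeasure {k : ℕ} {s : Set X} (hs : s.Countable) (g : (Fin k → X) → ENNReal) :
    ∫⁻ x, g x ∂tupleMeasure k s = ∑' x : distinctTuples k s, g x := by
  rw [tupleMeasure, lintegral_countable _ (hs.distinctTuples k)]
  simp

lemma isFiniteMeasure_tupleMeasure (k : ℕ) {s : Set X} (hs : s.Finite) :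
    IsFiniteMeasure (tupleMeasure k s) := by
  refine ⟨?_⟩
  rw [tupleMeasure, Measure.restrict_apply_univ]
  have : (distinctTuples k s).Finite := (Set.Finite.pi' fun _ => hs).subset fun x hx => hx.2
  exact Measure.count_apply_lt_top.2 this

variable [MeasurableSpace.CountablyGenerated X]

open Classical in
/-- The number of `k`-tuples of points of `s` in the rectangle `∏ j, A j` whose entries lie in
pairwise different cells. -/
noncomputable def cellSum {k : ℕ} (A : Fin k → Set X) (s : Set X) (n : ℕ) : ENNReal :=
  ∑ c : Fin k → Fin n → Bool, if Function.Injective c then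
    ∏ j, ((s ∩ (A j ∩ cell X n ⁻¹' {c j})).encard : ENNReal) else 0

lemma cellSum_eq_count {k : ℕ} (A : Fin k → Set X) {s : Set X} (hs : s.Countable) (n : ℕ) :
    cellSum A s n = Measure.count {x : Fin k → X |
      Function.Injective (fun j => cell X n (x j)) ∧ (∀ j, x j ∈ s) ∧ ∀ j, x j ∈ A j} := by
  classical
  have hU : {x : Fin k → X |
      Function.Injective (fun j => cell X n (x j)) ∧ (∀ j, x j ∈ s) ∧ ∀ j, x j ∈ A j} =
      ⋃ c ∈ Finset.univ.filter (fun c : Fin k → Fin n → Bool => Function.Injective c),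
        Set.univ.pi fun j => s ∩ (A j ∩ cell X n ⁻¹' {c j}) := by
    ext x
    simp only [Set.mem_iUnion, Finset.mem_filter, Finset.mem_univ, true_and, Set.mem_pi,
      Set.mem_univ, forall_true_left, Set.mem_inter_iff, Set.mem_preimage, Set.mem_singleton_iff,
      Set.mem_ofPred_eq]
    constructor
    · rintro ⟨h1, h2, h3⟩
      exact ⟨_, h1, fun j => ⟨h2 j, h3 j, rfl⟩⟩
    · rintro ⟨c, hc, h⟩
      have : (fun j => cell X n (x j)) = c := funext fun j => (h j).2.2
      exact ⟨this ▸ hc, fun j => (h j).1, fun j => (h j).2.1⟩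
  have hcount : ∀ c : Fin k → Fin n → Bool,
      (Set.univ.pi fun j => s ∩ (A j ∩ cell X n ⁻¹' {c j})).Countable := fun c =>
    (Set.countable_pi fun _ => hs).mono fun x hx j => (hx j trivial).1
  rw [hU, measure_biUnion_finset, cellSum, Finset.sum_filter]
  · refine Finset.sum_congr rfl fun c _ => ?_
    split_ifs
    · rw [Measure.count_apply (hcount c).measurableSet, Set.encard_pi_eq_prod_encard]
      exact (map_prod ENat.toENNRealRingHom _ _).symm
    · rfl
  · intro c _ d _ hcd
    refine Set.disjoint_left.2 fun x hx hy => hcd (funext fun j => ?_)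
    exact ((hx j trivial).2.2 : cell X n (x j) = c j).symm.trans (hy j trivial).2.2
  · exact fun c _ => (hcount c).measurableSet

lemma cellSum_mono {k : ℕ} (A : Fin k → Set X) {s : Set X} (hs : s.Countable) :
    Monotone (cellSum A s) := by
  intro m n hmn
  rw [cellSum_eq_count A hs, cellSum_eq_count A hs]
  exact measure_mono fun x hx => ⟨fun i j hij => hx.1 (cell_eq_of_le hmn hij), hx.2⟩

variable [MeasurableSpace.SeparatesPoints X]

/-- The entries of a tuple of distinct points are finitely many, hence separated at some level of
the partitions, so the separated tuples increase to all distinct ones. This makes the tuple measure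
a limit of polynomials in counts. -/
lemma tupleMeasure_pi {k : ℕ} {A : Fin k → Set X} (hA : ∀ j, MeasurableSet (A j)) {s : Set X}
    (hs : s.Countable) : tupleMeasure k s (Set.univ.pi A) = ⨆ n, cellSum A s n := by
  have hmono : Monotone fun n => {x : Fin k → X |
      Function.Injective (fun j => cell X n (x j)) ∧ (∀ j, x j ∈ s) ∧ ∀ j, x j ∈ A j} :=
    fun m n hmn x hx => ⟨fun i j hij => hx.1 (cell_eq_of_le hmn hij), hx.2⟩
  simp_rw [cellSum_eq_count A hs]
  rw [tupleMeasure, Measure.restrict_apply (MeasurableSet.univ_pi hA), ← hmono.measure_iUnion]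
  congr 1
  ext x
  simp only [Set.mem_inter_iff, Set.mem_pi, Set.mem_univ, forall_true_left, Set.mem_iUnion,
    Set.mem_ofPred_eq, distinctTuples]
  constructor
  · rintro ⟨h1, h2, h3⟩
    obtain ⟨n, hn⟩ := exists_injOn_cell (Set.finite_range x)
    exact ⟨n, fun i j hij => h2 (hn n le_rfl ⟨i, rfl⟩ ⟨j, rfl⟩ hij), h3, h1⟩
  · rintro ⟨n, h1, h2, h3⟩
    exact ⟨h3, fun i j hij => h1 (congrArg _ hij), h2⟩

end TupleMeasure

/-! ### Expected counts and products of counts -/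

section Moments

lemma lintegral_natCast_poissonMeasure (r : NNReal) :
    ∫⁻ n, (n : ENNReal) ∂poissonMeasure r = r := by
  rw [lintegral_countable', tsum_eq_zero_add' ENNReal.summable]
  simp only [Nat.cast_zero, zero_mul, zero_add, poissonMeasure_singleton]
  have h : ∀ n : ℕ, ((n + 1 : ℕ) : ENNReal) *
      ENNReal.ofReal (Real.exp (-r) * r ^ (n + 1) / (n + 1).factorial) =
      r * poissonMeasure r {n} := by
    intro n
    rw [poissonMeasure_singleton, ← ENNReal.ofReal_natCast, ← ENNReal.ofReal_coe_nnreal,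
      ← ENNReal.ofReal_mul (by positivity), ← ENNReal.ofReal_mul (by positivity)]
    congr 1
    rw [Nat.factorial_succ]
    push_cast
    have : (n.factorial : ℝ) ≠ 0 := by positivity
    field_simp
    ring
  simp_rw [h, ENNReal.tsum_mul_left]
  have : ∑' n : ℕ, poissonMeasure r {n} = 1 := by
    have := lintegral_countable' (μ := poissonMeasure r) (fun _ => 1)
    simpa using this.symm
  rw [this, mul_one]

namespace IsPoissonProcess

variable {X Ω : Type*} [TopologicalSpace X] [MeasurableSpace X] {μ : Measure X}
  [MeasurableSpace Ω] {P : Measure Ω} {η : Ω → PointConfig X} (hη : IsPoissonProcess η μ P)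

include hη

lemma measurable_count {A : Set X} (hA : MeasurableSet A) :
    Measurable fun ω => PointConfig.count A (η ω) :=
  (PointConfig.measurable_count hA).comp hη.measurable

lemma measurable_toENNReal_count {A : Set X} (hA : MeasurableSet A) :
    Measurable fun ω => (PointConfig.count A (η ω) : ENNReal) :=
  (Measurable.of_discrete (f := ((↑) : ℕ∞ → ENNReal))).comp (hη.measurable_count hA)

lemma lintegral_count {A : Set X} (hA : MeasurableSet A) (hfin : μ A < ⊤) :
    ∫⁻ ω, (PointConfig.count A (η ω) : ENNReal) ∂P = μ A := by
  rw [← lintegral_map (f := ((↑) : ℕ∞ → ENNReal)) .of_discrete (hη.measurable_count hA),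
    (hη.law_count A hA hfin).map_eq, lintegral_map .of_discrete .of_discrete]
  simp only [ENat.toENNReal_coe]
  rw [lintegral_natCast_poissonMeasure, ENNReal.coe_toNNReal hfin.ne]

lemma ae_count_lt_top {A : Set X} (hA : MeasurableSet A) (hfin : μ A < ⊤) :
    ∀ᵐ ω ∂P, PointConfig.count A (η ω) < ⊤ := by
  have := ae_lt_top (hη.measurable_toENNReal_count hA) (by
    rw [hη.lintegral_count hA hfin]; exact hfin.ne)
  filter_upwards [this] with ω hω
  simpa using hω

lemma lintegral_prod_count {k : ℕ} {A : Fin k → Set X} (hA : ∀ j, MeasurableSet (A j))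
    (hfin : ∀ j, μ (A j) < ⊤) (hdisj : Pairwise fun i j => Disjoint (A i) (A j)) :
    ∫⁻ ω, ∏ j, (PointConfig.count (A j) (η ω) : ENNReal) ∂P = ∏ j, μ (A j) := by
  have hind := (hη.indep_count k A hA hdisj).comp (fun _ => ((↑) : ℕ∞ → ENNReal))
    fun _ => .of_discrete
  rw [show (fun ω => ∏ j, (PointConfig.count (A j) (η ω) : ENNReal)) = fun ω => ∏ j,
    ((fun i => ((↑) : ℕ∞ → ENNReal) ∘ fun ω => PointConfig.count (A i) (η ω)) j ω) from rfl,
    lintegral_prod_eq_prod_lintegral_of_indepFun Finset.univ _ hind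
      fun j => hη.measurable_toENNReal_count (hA j)]
  exact Finset.prod_congr rfl fun j _ => hη.lintegral_count (hA j) (hfin j)

variable [MeasurableSpace.CountablyGenerated X]

lemma measurable_cellSum {k : ℕ} {A : Fin k → Set X} (hA : ∀ j, MeasurableSet (A j)) (n : ℕ) :
    Measurable fun ω => cellSum A (η ω).points n := by
  refine Finset.measurable_sum _ fun c _ => ?_
  split_ifs
  · exact Finset.measurable_prod _ fun j _ =>
      hη.measurable_toENNReal_count ((hA j).inter (measurableSet_cell_fiber n (c j)))
  · exact measurable_const

/-- Distinct cells are disjoint, so the counts are independent and expectations factor. Adding the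
non-injective index tuples completes the sum to a product; this is why only an inequality appears.
-/
lemma lintegral_cellSum_le {k : ℕ} {A : Fin k → Set X} (hA : ∀ j, MeasurableSet (A j))
    (hfin : ∀ j, μ (A j) < ⊤) (n : ℕ) :
    ∫⁻ ω, cellSum A (η ω).points n ∂P ≤ ∏ j, μ (A j) := by
  classical
  have hm : ∀ (c : Fin k → Fin n → Bool) j, MeasurableSet (A j ∩ cell X n ⁻¹' {c j}) :=
    fun c j => (hA j).inter (measurableSet_cell_fiber n (c j))
  simp only [cellSum]
  rw [lintegral_finsetSum]
  · have hcell : ∀ j, ∑ c : Fin n → Bool, μ (A j ∩ cell X n ⁻¹' {c}) = μ (A j) := by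
      intro j
      rw [← measure_biUnion_finset]
      · congr 1
        ext x
        simp
      · intro c _ d _ hcd
        refine Set.disjoint_left.2 fun x hx hy => hcd ?_
        exact (hx.2 : cell X n x = c).symm.trans hy.2
      · exact fun c _ => (hA j).inter (measurableSet_cell_fiber n c)
    calc _ ≤ ∑ c : Fin k → Fin n → Bool, ∏ j, μ (A j ∩ cell X n ⁻¹' {c j}) := by
          refine Finset.sum_le_sum fun c _ => ?_
          split_ifs with hc
          · refine (hη.lintegral_prod_count (hm c)
              (fun j => (measure_mono Set.inter_subset_left).trans_lt (hfin j)) ?_).le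
            intro i j hij
            refine Set.disjoint_left.2 fun x hx hy => hij (hc ?_)
            exact (hx.2 : cell X n x = c i).symm.trans hy.2
          · simp
      _ = ∏ j, ∑ c : Fin n → Bool, μ (A j ∩ cell X n ⁻¹' {c}) := by
          rw [Finset.prod_univ_sum, Fintype.piFinset_univ]
      _ = _ := Finset.prod_congr rfl fun j _ => hcell j
  · intro c _
    split_ifs
    · exact Finset.measurable_prod _ fun j _ => hη.measurable_toENNReal_count (hm c j)
    · exact measurable_const

end IsPoissonProcess

lemma cellSum_inter {X : Type*} [MeasurableSpace X] [MeasurableSpace.CountablyGenerated X] {k : ℕ}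
    (A : Fin k → Set X) (s V : Set X) (n : ℕ) :
    cellSum A (s ∩ V) n = cellSum (fun j => A j ∩ V) s n := by
  simp only [cellSum]
  refine Finset.sum_congr rfl fun c _ => ?_
  congr! 4 with h j
  ext x
  simp only [Set.mem_inter_iff]
  tauto

end Moments

/-! ### The factorial moment bound -/

section FactorialMoments

/-- The product outer measure is the largest one bounded by the products on rectangles. Rectangles
with arbitrary sides are handled by passing to measurable hulls. -/
lemma le_measure_pi_of_pi_le {X : Type*} [MeasurableSpace X] {k : ℕ} {μ : Measure X} [SigmaFinite μ] {M : Measure (Fin k → X)}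
    (h : ∀ A : Fin k → Set X, (∀ j, MeasurableSet (A j)) → M (Set.univ.pi A) ≤ ∏ j, μ (A j)) :
    M ≤ Measure.pi fun _ => μ := by
  refine Measure.le_iff.2 fun s hs => ?_
  rw [Measure.pi, toMeasure_apply _ _ hs]
  suffices M.toOuterMeasure ≤ OuterMeasure.pi fun _ => μ.toOuterMeasure from this s
  refine OuterMeasure.le_pi.2 fun A _ => ?_
  calc M (Set.univ.pi A) ≤ M (Set.univ.pi fun j => toMeasurable μ (A j)) :=
        measure_mono (Set.pi_mono fun j _ => subset_toMeasurable _ _)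
    _ ≤ ∏ j, μ (toMeasurable μ (A j)) := h _ fun j => measurableSet_toMeasurable _ _
    _ = ∏ j, μ (A j) := by simp_rw [measure_toMeasurable]

lemma lintegral_tupleMeasure_eq_iSup {X : Type*} [MeasurableSpace X] {k : ℕ} (V : ℕ → Set X) (hV : Monotone V)
    (hcov : ⋃ n, V n = Set.univ) {s : Set X} {g : (Fin k → X) → ENNReal} :
    ∫⁻ x, g x ∂tupleMeasure k s = ⨆ n, ∫⁻ x, g x ∂tupleMeasure k (s ∩ V n) := by
  have hmono : Monotone fun n => distinctTuples k (s ∩ V n) :=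
    fun m n hmn x hx => ⟨hx.1, fun i => ⟨(hx.2 i).1, hV hmn (hx.2 i).2⟩⟩
  have hU : distinctTuples k s = ⋃ n, distinctTuples k (s ∩ V n) := by
    refine subset_antisymm (fun x hx => ?_)
      (Set.iUnion_subset fun n x hx => ⟨hx.1, fun i => (hx.2 i).1⟩)
    have : ∀ i, ∃ n, x i ∈ V n := fun i => Set.mem_iUnion.1 (hcov ▸ Set.mem_univ (x i))
    choose n hn using this
    exact Set.mem_iUnion.2 ⟨Finset.univ.sup n, hx.1, fun i => ⟨hx.2 i,
      hV (Finset.le_sup (Finset.mem_univ i)) (hn i)⟩⟩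
  rw [tupleMeasure, hU, setLIntegral_iUnion_of_directed _ hmono.directed_le]
  rfl

open Classical in
/-- The counting measure on the `k`-tuples of pairwise distinct points of `ξ` in `V`, set to `0` if
there are infinitely many points. -/
noncomputable def windowTupleMeasure {X : Type*} [TopologicalSpace X] [MeasurableSpace X] (k : ℕ)
    (V : Set X) (ξ : PointConfig X) : Measure (Fin k → X) :=
  if PointConfig.count V ξ = ⊤ then 0 else tupleMeasure k (ξ.points ∩ V)

lemma IsPoissonProcess.windowTupleMeasure_ae_eq {X Ω : Type*} [TopologicalSpace X] [MeasurableSpace X] {μ : Measure X}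
    [MeasurableSpace Ω] {P : Measure Ω} {η : Ω → PointConfig X} (hη : IsPoissonProcess η μ P) (k : ℕ) {V : Set X} (hV : MeasurableSet V) (hfin : μ V < ⊤) :
    ∀ᵐ ω ∂P, windowTupleMeasure k V (η ω) = tupleMeasure k ((η ω).points ∩ V) := by
  filter_upwards [hη.ae_count_lt_top hV hfin] with ω hω
  rw [windowTupleMeasure, if_neg hω.ne]

variable {X Ω : Type*} [TopologicalSpace X] [PolishSpace X] [MeasurableSpace X] [BorelSpace X]

instance isFiniteMeasure_windowTupleMeasure (k : ℕ) (V : Set X) (ξ : PointConfig X) :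
    IsFiniteMeasure (windowTupleMeasure k V ξ) := by
  rw [windowTupleMeasure]
  split_ifs with h
  · infer_instance
  · exact isFiniteMeasure_tupleMeasure k (Set.encard_ne_top_iff.1 h)

lemma windowTupleMeasure_pi {k : ℕ} {A : Fin k → Set X} (hA : ∀ j, MeasurableSet (A j))
    (V : Set X) (ξ : PointConfig X) (hξ : PointConfig.count V ξ ≠ ⊤) :
    windowTupleMeasure k V ξ (Set.univ.pi A) =
      ⨆ n, cellSum (fun j => A j ∩ V) ξ.points n := by
  rw [windowTupleMeasure, if_neg hξ,
    tupleMeasure_pi hA (ξ.countable_points.mono Set.inter_subset_left)]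
  simp_rw [cellSum_inter]

variable {μ : Measure X} [MeasurableSpace Ω] {P : Measure Ω} {η : Ω → PointConfig X}

namespace IsPoissonProcess

variable (hη : IsPoissonProcess η μ P)

include hη

/-- Rectangles form a generating π-system and suffice as a test, because the default value `0` makes
the measures finite for every `ω`, not just almost every one. -/
lemma measurable_windowTupleMeasure (k : ℕ) {V : Set X} (hV : MeasurableSet V) :
    Measurable fun ω => windowTupleMeasure k V (η ω) := by
  classical
  have hpi : ∀ A : Fin k → Set X, (∀ j, MeasurableSet (A j)) →
      Measurable fun ω => windowTupleMeasure k V (η ω) (Set.univ.pi A) := by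
    intro A hA
    have : (fun ω => windowTupleMeasure k V (η ω) (Set.univ.pi A)) =
        fun ω => if PointConfig.count V (η ω) = ⊤ then 0 else
          ⨆ n, cellSum (fun j => A j ∩ V) (η ω).points n := by
      funext ω
      split_ifs with h
      · rw [windowTupleMeasure, if_pos h]; rfl
      · exact windowTupleMeasure_pi hA V (η ω) h
    rw [this]
    exact Measurable.ite (hη.measurable_count hV (measurableSet_singleton _)) measurable_const
      (Measurable.iSup fun n => hη.measurable_cellSum (fun j => (hA j).inter hV) n)
  refine Measurable.measure_of_isPiSystem generateFrom_pi.symm isPiSystem_pi ?_ ?_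
  · rintro _ ⟨A, hA, rfl⟩
    exact hpi A fun j => hA j trivial
  · simpa using hpi (fun _ => Set.univ) fun _ => MeasurableSet.univ

lemma bind_windowTupleMeasure_le [SigmaFinite μ] (k : ℕ) {V : Set X} (hV : MeasurableSet V)
    (hfin : μ V < ⊤) :
    P.bind (fun ω => windowTupleMeasure k V (η ω)) ≤ Measure.pi fun _ => μ := by
  refine le_measure_pi_of_pi_le fun A hA => ?_
  have hAV : ∀ j, MeasurableSet (A j ∩ V) := fun j => (hA j).inter hV
  rw [Measure.bind_apply (MeasurableSet.univ_pi hA)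
    (hη.measurable_windowTupleMeasure k hV).aemeasurable]
  calc _ = ∫⁻ ω, ⨆ n, cellSum (fun j => A j ∩ V) (η ω).points n ∂P := by
        refine lintegral_congr_ae ?_
        filter_upwards [hη.ae_count_lt_top hV hfin] with ω hω
        exact windowTupleMeasure_pi hA V (η ω) hω.ne
    _ = ⨆ n, ∫⁻ ω, cellSum (fun j => A j ∩ V) (η ω).points n ∂P :=
        lintegral_iSup (hη.measurable_cellSum hAV)
          fun m n hmn ω => cellSum_mono _ (η ω).countable_points hmn
    _ ≤ ∏ j, μ (A j ∩ V) := iSup_le fun n => hη.lintegral_cellSum_le hAV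
        (fun j => (measure_mono Set.inter_subset_right).trans_lt hfin) n
    _ ≤ ∏ j, μ (A j) := Finset.prod_le_prod' fun j _ => measure_mono Set.inter_subset_left

/-- The factorial moment bound: the expected sum of `g` over the `k`-tuples of distinct points of a
Poisson process is at most the integral of `g`. -/
theorem lintegral_lintegral_tupleMeasure_le [SigmaFinite μ] {k : ℕ} {g : (Fin k → X) → ENNReal}
    (hg : Measurable g) :
    AEMeasurable (fun ω => ∫⁻ x, g x ∂tupleMeasure k (η ω).points) P ∧
    ∫⁻ ω, ∫⁻ x, g x ∂tupleMeasure k (η ω).points ∂P ≤ ∫⁻ x, g x ∂Measure.pi fun _ => μ := by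
  have hVm := measurableSet_spanningSets μ
  have hVf := measure_spanningSets_lt_top μ
  have hmeas : ∀ n, Measurable fun ω =>
      ∫⁻ x, g x ∂windowTupleMeasure k (spanningSets μ n) (η ω) := fun n =>
    (Measure.measurable_lintegral hg).comp (hη.measurable_windowTupleMeasure k (hVm n))
  have hall : ∀ᵐ ω ∂P, ∀ n, windowTupleMeasure k (spanningSets μ n) (η ω) =
      tupleMeasure k ((η ω).points ∩ spanningSets μ n) :=
    ae_all_iff.2 fun n => hη.windowTupleMeasure_ae_eq k (hVm n) (hVf n)
  have hae : (fun ω => ∫⁻ x, g x ∂tupleMeasure k (η ω).points) =ᵐ[P]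
      fun ω => ⨆ n, ∫⁻ x, g x ∂windowTupleMeasure k (spanningSets μ n) (η ω) := by
    filter_upwards [hall] with ω hω
    simp_rw [hω]
    exact lintegral_tupleMeasure_eq_iSup _ (monotone_spanningSets μ) (iUnion_spanningSets μ)
  refine ⟨⟨_, Measurable.iSup hmeas, hae⟩, ?_⟩
  -- Monotone convergence over windows of finite measure reduces the bound to the intensity measure
  -- of the tuples in one window.
  rw [lintegral_congr_ae hae, lintegral_iSup' (fun n => (hmeas n).aemeasurable)]
  · refine iSup_le fun n => ?_
    rw [← Measure.lintegral_bind (hη.measurable_windowTupleMeasure k (hVm n)).aemeasurable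
      hg.aemeasurable]
    exact lintegral_mono' (hη.bind_windowTupleMeasure_le k (hVm n) (hVf n)) le_rfl
  · filter_upwards [hall] with ω hω m n hmn
    simp only [hω]
    have hsub : distinctTuples k ((η ω).points ∩ spanningSets μ m) ⊆
        distinctTuples k ((η ω).points ∩ spanningSets μ n) :=
      fun x hx => ⟨hx.1, fun i => ⟨(hx.2 i).1, monotone_spanningSets μ hmn (hx.2 i).2⟩⟩
    exact lintegral_mono' (Measure.restrict_mono hsub le_rfl) le_rfl

end IsPoissonProcess

end FactorialMoments

/-! ### Approximation by functions of the cells -/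

section Approximation

variable {X : Type*} [MeasurableSpace X] [MeasurableSpace.CountablyGenerated X]

open Classical in
/-- The function on `V^k` that depends on the cells of the entries only, through `g`, extended by
`0`. -/
noncomputable def cellFunction {k : ℕ} (V : Set X) (n : ℕ) (g : (Fin k → Fin n → Bool) → ℝ)
    (x : Fin k → X) : ℝ :=
  if ∀ j, x j ∈ V then g (fun j => cell X n (x j)) else 0

lemma measurable_cellFunction {k : ℕ} {V : Set X} (hV : MeasurableSet V) (n : ℕ)
    (g : (Fin k → Fin n → Bool) → ℝ) : Measurable (cellFunction V n g) := by
  refine Measurable.ite ?_ (Measurable.comp .of_discrete (measurable_pi_iff.2 fun j =>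
    (measurable_cell n).comp (measurable_pi_apply j))) measurable_const
  rw [Set.ofPred_forall]
  exact MeasurableSet.iInter fun j => measurable_pi_apply j hV

lemma measurable_pi_pi_iff {Y ι κ Z : Type*} {mY : MeasurableSpace Y} [MeasurableSpace Z]
    {φ : Y → ι → κ → Z} : Measurable φ ↔ ∀ j i, Measurable fun y => φ y j i := by
  simp_rw [measurable_pi_iff]

variable (X) in
/-- The filtration on `X^k` given by the cells of the entries. -/
noncomputable def cellFiltration (k : ℕ) :
    Filtration ℕ (inferInstance : MeasurableSpace (Fin k → X)) where
  seq n := MeasurableSpace.comap (fun x j => cell X n (x j)) inferInstance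
  mono' m n hmn := by
    rw [← measurable_iff_comap_le, measurable_pi_pi_iff]
    intro j i
    exact measurable_pi_pi_iff.1 (comap_measurable fun (x : Fin k → X) j => cell X n (x j)) j
      (Fin.castLE hmn i)
  le' n := by
    rw [← measurable_iff_comap_le]
    exact measurable_pi_iff.2 fun j => (measurable_cell n).comp (measurable_pi_apply j)

/-- An injective measurable map out of a standard Borel space is a measurable embedding, so
measurability for any σ-algebra on `Y` can be tested on binary digits. -/
lemma measurable_of_measurable_mapNatBool {X Y ι : Type*} [MeasurableSpace X]
    [StandardBorelSpace X] {mY : MeasurableSpace Y} {φ : Y → ι → X}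
    (h : ∀ j i, Measurable fun y => MeasurableSpace.mapNatBool X (φ y j) i) : Measurable φ := by
  have hemb : MeasurableEmbedding (MeasurableSpace.mapNatBool X) :=
    (MeasurableSpace.measurable_mapNatBool X).measurableEmbedding
      (MeasurableSpace.injective_mapNatBool X)
  refine measurable_pi_iff.2 fun j => ?_
  rw [← hemb.measurable_comp_iff]
  exact measurable_pi_iff.2 fun i => h j i

lemma iSup_cellFiltration {X : Type*} [MeasurableSpace X] [StandardBorelSpace X] (k : ℕ) :
    ⨆ n, cellFiltration X k n = (inferInstance : MeasurableSpace (Fin k → X)) := by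
  refine le_antisymm (iSup_le fun n => (cellFiltration X k).le n) ?_
  suffices Measurable[⨆ n, cellFiltration X k n] (fun x : Fin k → X => x) by
    intro s hs
    exact this hs
  refine measurable_of_measurable_mapNatBool fun j i => ?_
  exact (measurable_pi_pi_iff.1 (comap_measurable fun (x : Fin k → X) j => cell X (i + 1) (x j)) j
    (Fin.last i)).mono (le_iSup (fun n => cellFiltration X k n) (i + 1)) le_rfl

/-- Integrable nonnegative functions on `X^k` can be approximated in `L¹` by functions of the
cells. -/
theorem exists_cellFunction_approx {X : Type*} [MeasurableSpace X] [StandardBorelSpace X]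
    {μ : Measure X} [SigmaFinite μ] {k : ℕ} {f : (Fin k → X) → ℝ} (hf : Measurable f)
    (hf0 : ∀ x, 0 ≤ f x) (hfi : Integrable f (Measure.pi fun _ : Fin k => μ)) {δ : ENNReal}
    (hδ : 0 < δ) :
    ∃ N n₀, ∀ n, n₀ ≤ n → ∃ g : (Fin k → Fin n → Bool) → ℝ, (∀ c, 0 ≤ g c) ∧
      ∫⁻ x, ‖f x - cellFunction (spanningSets μ N) n g x‖ₑ ∂(Measure.pi fun _ : Fin k => μ)
        ≤ δ := by
  set π := Measure.pi fun _ : Fin k => μ with hπ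
  set W : ℕ → Set (Fin k → X) := fun N => Set.univ.pi fun _ => spanningSets μ N with hWdef
  have hWm : ∀ N, MeasurableSet (W N) := fun N =>
    MeasurableSet.univ_pi fun _ => measurableSet_spanningSets μ N
  have hWmono : Monotone W := fun M N h => Set.pi_mono fun _ _ => monotone_spanningSets μ h
  have hδ2 : 0 < δ / 2 := ENNReal.half_pos hδ.ne'
  -- Half of the error pays for truncation to a product set of finite measure, where conditional
  -- expectations converge.
  obtain ⟨N, hN⟩ : ∃ N, ∫⁻ x in (W N)ᶜ, ‖f x‖ₑ ∂π < δ / 2 := by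
    have hlim : Filter.Tendsto (fun N => (π.withDensity fun x => ‖f x‖ₑ) (W N)ᶜ) Filter.atTop
        (𝓝 ((π.withDensity fun x => ‖f x‖ₑ) (⋂ N, (W N)ᶜ))) := by
      refine tendsto_measure_iInter_atTop (fun N => (hWm N).compl.nullMeasurableSet)
        (fun M N h => Set.compl_subset_compl.2 (hWmono h)) ⟨0, ?_⟩
      rw [withDensity_apply _ (hWm 0).compl]
      exact ((setLIntegral_le_lintegral _ _).trans_lt hfi.2).ne
    have hempty : ⋂ N, (W N)ᶜ = ∅ := by
      refine Set.eq_empty_iff_forall_notMem.2 fun x hx => ?_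
      have : ∀ i, ∃ n, x i ∈ spanningSets μ n := fun i => ⟨_, mem_spanningSetsIndex μ (x i)⟩
      choose n hn using this
      exact Set.mem_iInter.1 hx (Finset.univ.sup n) fun i _ =>
        monotone_spanningSets μ (Finset.le_sup (Finset.mem_univ i)) (hn i)
    rw [hempty, measure_empty] at hlim
    obtain ⟨N, hN⟩ := (hlim.eventually_lt_const hδ2).exists
    rw [withDensity_apply _ (hWm N).compl] at hN
    exact ⟨N, hN⟩
  have hfin : IsFiniteMeasure (π.restrict (W N)) := by
    refine ⟨?_⟩
    rw [Measure.restrict_apply_univ, hπ, hWdef, Measure.pi_pi]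
    exact ENNReal.prod_lt_top fun _ _ => measure_spanningSets_lt_top μ N
  -- Lévy's upward theorem in `L¹`: the cells generate the whole σ-algebra.
  have hlim := Integrable.tendsto_eLpNorm_condExp (ℱ := cellFiltration X k)
    (hfi.mono_measure (Measure.restrict_le_self (s := W N)))
    (by rw [iSup_cellFiltration]; exact hf.stronglyMeasurable)
  obtain ⟨n₀, hn₀⟩ := Filter.eventually_atTop.1 (hlim.eventually_lt_const hδ2)
  refine ⟨N, n₀, fun n hn => ?_⟩
  have hfac := (stronglyMeasurable_condExp (m := cellFiltration X k n) (f := f)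
    (μ := π.restrict (W N))).factorsThrough (f := fun (x : Fin k → X) j => cell X n (x j))
  obtain ⟨g, hg⟩ := (Function.factorsThrough_iff _).1 hfac
  -- Since `f` is nonnegative, taking the positive part does not increase the error.
  refine ⟨fun c => max (g c) 0, fun c => le_max_right _ _, ?_⟩
  rw [← lintegral_add_compl _ (hWm N), ← ENNReal.add_halves δ]
  refine add_le_add (le_trans ?_ (hn₀ n hn).le) (le_trans ?_ hN.le)
  · rw [eLpNorm_one_eq_lintegral_enorm]
    refine setLIntegral_mono' (hWm N) fun x hx => ?_
    have hx' : ∀ j, x j ∈ spanningSets μ N := fun j => hx j trivial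
    rw [cellFunction, if_pos hx', Pi.sub_apply, hg, Function.comp_apply, enorm_le_iff_norm_le,
      Real.norm_eq_abs, Real.norm_eq_abs, abs_sub_comm (g _)]
    have := abs_max_sub_max_le_abs (f x) (g fun j => cell X n (x j)) 0
    rwa [max_eq_left (hf0 x)] at this
  · refine setLIntegral_mono' (hWm N).compl fun x hx => ?_
    have hx' : ¬ ∀ j, x j ∈ spanningSets μ N := fun h => hx fun j _ => h j
    rw [cellFunction, if_neg hx', sub_zero]

end Approximation

/-! ### Talagrand's inequality for independent Boolean random variables -/

section BooleanTalagrand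

variable {Ω : Type*} [MeasurableSpace Ω] {P : Measure Ω}

open DiscreteCube in
lemma measureReal_mem_eq_mass [IsProbabilityMeasure P] {n : ℕ} {Z : Fin n → Ω → Bool}
    (hZ : ∀ i, Measurable (Z i)) (hind : iIndepFun Z P) (A : Set (Fin n → Bool)) :
    P.real {ω | (fun i => Z i ω) ∈ A} = mass (fun i => P.real {ω | Z i ω = true}) A := by
  classical
  have hpoint : ∀ x : Fin n → Bool, P.real {ω | (fun i => Z i ω) = x} =
      weight (fun i => P.real {ω | Z i ω = true}) x := by
    intro x
    have hx : {ω | (fun i => Z i ω) = x} = ⋂ i ∈ (Finset.univ : Finset (Fin n)),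
        Z i ⁻¹' {x i} := by
      ext ω
      simp [funext_iff]
    rw [measureReal_def, hx, hind.measure_inter_preimage_eq_mul Finset.univ
      fun i _ => measurableSet_singleton _, ENNReal.toReal_prod, weight]
    refine Finset.prod_congr rfl fun i _ => ?_
    have hm : MeasurableSet {ω | Z i ω = true} := hZ i (measurableSet_singleton true)
    cases hxi : x i
    · rw [if_neg (by simp), ← probReal_compl_eq_one_sub hm, measureReal_def]
      congr 2
      ext ω
      simp
    · rw [if_pos rfl]
      rfl
  have hA : {ω | (fun i => Z i ω) ∈ A} =
      ⋃ x ∈ Finset.univ.filter (· ∈ A), {ω | (fun i => Z i ω) = x} := by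
    ext ω
    simp
  rw [hA, measureReal_biUnion_finset, mass, Finset.sum_filter]
  · exact Finset.sum_congr rfl fun x _ => by rw [hpoint]
  · intro x _ y _ hxy
    exact Set.disjoint_left.2 fun ω hx hy => hxy (hx.symm.trans hy)
  · exact fun x _ => measurable_pi_iff.2 hZ (measurableSet_singleton x)

/-- Talagrand's inequality for independent Boolean random variables. -/
theorem measureReal_mem_mul_measureReal_mem_le [IsProbabilityMeasure P] {ι : Type*} [Fintype ι]
    {Z : ι → Ω → Bool} (hZ : ∀ i, Measurable (Z i)) (hind : iIndepFun Z P) {A S : Set (ι → Bool)}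
    {s : ℝ} (hs : 0 ≤ s)
    (h : ∀ z ∈ S, ∃ a : ι → ℝ, ∑ i, a i ^ 2 ≤ 1 ∧
      ∀ y ∈ A, s ≤ ∑ i, a i * if z i = y i then 0 else 1) :
    P.real {ω | (fun i => Z i ω) ∈ A} * P.real {ω | (fun i => Z i ω) ∈ S} ≤
      Real.exp (-(s ^ 2 / 4)) := by
  set e := Fintype.equivFin ι
  have hmass : ∀ B : Set (ι → Bool), P.real {ω | (fun i => Z i ω) ∈ B} =
      DiscreteCube.mass (fun i => P.real {ω | Z (e.symm i) ω = true}) {y | y ∘ e ∈ B} := by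
    intro B
    rw [← measureReal_mem_eq_mass (fun i => hZ (e.symm i))
      (hind.precomp (g := e.symm) e.symm.injective)]
    congr 1
    ext ω
    simp [Function.comp_def]
  rw [hmass, hmass]
  refine DiscreteCube.mass_mul_mass_le (fun i => measureReal_nonneg) (fun i => measureReal_le_one)
    hs fun z hz => ?_
  obtain ⟨a, ha, hay⟩ := h _ hz
  refine ⟨a ∘ e.symm, ?_, fun y hy => ?_⟩
  · rw [← Equiv.sum_comp e]
    simpa using ha
  · rw [← Equiv.sum_comp e]
    simpa [DiscreteCube.mismatch] using hay _ hy

end BooleanTalagrand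

/-! ### U-statistics of Boolean configurations -/

section CellStatistics

variable {ι : Type*} [Fintype ι] {k : ℕ}

open Classical in
/-- The sum of `g` over the injective `k`-tuples of sites occupied in `z`. -/
noncomputable def cellUStatistic (g : (Fin k → ι) → ℝ) (z : ι → Bool) : ℝ :=
  ∑ c, if Function.Injective c ∧ ∀ j, z (c j) = true then g c else 0

/-- The part of `cellUStatistic g z` coming from the tuples through `i`. -/
noncomputable def cellInfluence (g : (Fin k → ι) → ℝ) (z : ι → Bool) (i : ι) : ℝ :=
  cellUStatistic (Set.indicator {c | ∃ j, c j = i} g) z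

variable {g : (Fin k → ι) → ℝ} (hg : ∀ c, 0 ≤ g c)

include hg

lemma cellUStatistic_nonneg (z : ι → Bool) : 0 ≤ cellUStatistic g z := by
  refine Finset.sum_nonneg fun c _ => ?_
  split_ifs
  exacts [hg c, le_rfl]

lemma cellInfluence_nonneg (z : ι → Bool) (i : ι) : 0 ≤ cellInfluence g z i := by
  exact cellUStatistic_nonneg (Set.indicator_nonneg fun c _ => hg c) z

/-- A tuple counted in `z` but not in `y` uses a site where they differ and is charged to that site.
-/
lemma cellUStatistic_sub_le (z y : ι → Bool) : cellUStatistic g z - cellUStatistic g y ≤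
    ∑ i, cellInfluence g z i * if z i = y i then 0 else 1 := by
  classical
  simp only [cellInfluence, cellUStatistic, Set.indicator_apply, Set.mem_ofPred_eq, Finset.sum_mul]
  rw [Finset.sum_comm, ← Finset.sum_sub_distrib]
  refine Finset.sum_le_sum fun c _ => ?_
  have hterm : ∀ i, 0 ≤ (if Function.Injective c ∧ ∀ j, z (c j) = true then
      (if ∃ j, c j = i then g c else 0) else 0) * if z i = y i then (0 : ℝ) else 1 := by
    intro i
    have := hg c
    split_ifs <;> simp [this]
  by_cases hz : Function.Injective c ∧ ∀ j, z (c j) = true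
  · by_cases hy : Function.Injective c ∧ ∀ j, y (c j) = true
    · rw [if_pos hz, if_pos hy, sub_self]
      exact Finset.sum_nonneg fun i _ => if_pos hz ▸ hterm i
    · obtain ⟨j, hj⟩ : ∃ j, y (c j) ≠ true := by
        by_contra! h
        exact hy ⟨hz.1, h⟩
      have hne : z (c j) ≠ y (c j) := by rw [hz.2 j]; exact hj.symm
      rw [if_neg hy, sub_zero]
      refine le_trans (le_of_eq ?_) (Finset.single_le_sum (fun i _ => hterm i)
        (Finset.mem_univ (c j)))
      rw [if_neg hne, if_pos (⟨j, rfl⟩ : ∃ j', c j' = c j), mul_one]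
  · rw [if_neg hz]
    refine le_trans ?_ (Finset.sum_nonneg fun i _ => hterm i)
    have := hg c
    split_ifs <;> simp [this]

/-- Double counting: a tuple passes through at most `k` sites. -/
lemma sum_cellInfluence_le (z : ι → Bool) :
    ∑ i, cellInfluence g z i ≤ k * cellUStatistic g z := by
  classical
  simp only [cellInfluence, cellUStatistic, Set.indicator_apply, Set.mem_ofPred_eq]
  rw [Finset.sum_comm, Finset.mul_sum]
  refine Finset.sum_le_sum fun c _ => ?_
  split_ifs
  · rw [← Finset.sum_filter, Finset.sum_const, nsmul_eq_mul]
    refine mul_le_mul_of_nonneg_right ?_ (hg c)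
    have : Finset.univ.filter (fun i => ∃ j, c j = i) = Finset.univ.image c := by
      ext i
      simp
    rw [this]
    exact_mod_cast Finset.card_image_le.trans_eq (Finset.card_fin k)
  · simp

lemma sum_cellInfluence_sq_le {z : ι → Bool} {K : ℝ} (hK0 : 0 ≤ K)
    (hK : ∀ i, cellInfluence g z i ≤ K) :
    ∑ i, cellInfluence g z i ^ 2 ≤ K * (k * cellUStatistic g z) := by
  calc _ ≤ ∑ i, K * cellInfluence g z i := by
        refine Finset.sum_le_sum fun i _ => ?_
        rw [sq]
        exact mul_le_mul_of_nonneg_right (hK i) (cellInfluence_nonneg hg z i)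
    _ = K * ∑ i, cellInfluence g z i := by rw [Finset.mul_sum]
    _ ≤ _ := mul_le_mul_of_nonneg_left (sum_cellInfluence_le hg z) hK0

end CellStatistics

/-- The function `√t - a / √t` is increasing, so a separation computed at level `b` persists
wherever the statistic exceeds `b`. -/
lemma sub_div_sqrt_mono {a b t : ℝ} (ha : 0 ≤ a) (hb : 0 < b) (hbt : b ≤ t) :
    (b - a) / √b ≤ (t - a) / √t := by
  have ht : 0 < t := hb.trans_le hbt
  have hb' := Real.sqrt_pos.2 hb
  have ht' := Real.sqrt_pos.2 ht
  have hle : √b ≤ √t := Real.sqrt_le_sqrt hbt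
  rw [div_le_div_iff₀ hb' ht']
  have h1 := Real.sq_sqrt hb.le
  have h2 := Real.sq_sqrt ht.le
  nlinarith [mul_nonneg (mul_nonneg hb'.le ht'.le) (sub_nonneg.2 hle),
    mul_nonneg ha (sub_nonneg.2 hle)]

/-- The two-set concentration bound for U-statistics of independent Boolean variables. -/
theorem cellUStatistic_concentration {Ω : Type*} [MeasurableSpace Ω] {P : Measure Ω}
    [IsProbabilityMeasure P] {ι : Type*} [Fintype ι] {k : ℕ} (hk : 0 < k)
    {g : (Fin k → ι) → ℝ} (hg : ∀ c, 0 ≤ g c) {Z : ι → Ω → Bool} (hZ : ∀ i, Measurable (Z i))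
    (hind : iIndepFun Z P) {a b K : ℝ} (ha : 0 ≤ a) (hab : a < b) (hK : 0 < K) :
    P.real {ω | cellUStatistic g (fun i => Z i ω) ≤ a} *
      P.real {ω | b ≤ cellUStatistic g (fun i => Z i ω) ∧
        ∀ i, cellInfluence g (fun i => Z i ω) i ≤ K} ≤
      Real.exp (-((b - a) ^ 2 / (4 * (K * k * b)))) := by
  have hb : 0 < b := ha.trans_lt hab
  have hk' : (0 : ℝ) < k := Nat.cast_pos.2 hk
  have hKk : 0 < K * k := mul_pos hK hk'
  have hs : ((b - a) / √b / √(K * k)) ^ 2 / 4 = (b - a) ^ 2 / (4 * (K * k * b)) := by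
    rw [div_pow, div_pow, Real.sq_sqrt hb.le, Real.sq_sqrt hKk.le]
    field_simp
  rw [← hs]
  refine measureReal_mem_mul_measureReal_mem_le hZ hind (A := {z | cellUStatistic g z ≤ a})
    (S := {z | b ≤ cellUStatistic g z ∧ ∀ i, cellInfluence g z i ≤ K})
    (div_nonneg (div_nonneg (by linarith) (Real.sqrt_nonneg _)) (Real.sqrt_nonneg _)) ?_
  rintro z ⟨hzb, hzK⟩
  set t := cellUStatistic g z with ht
  have ht0 : 0 < t := hb.trans_le hzb
  -- The squared influences sum to at most `K * k * t`, so this vector has norm at most `1`.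
  refine ⟨fun i => cellInfluence g z i / √t / √(K * k), ?_, fun y hy => ?_⟩
  · simp_rw [div_pow, Real.sq_sqrt ht0.le, Real.sq_sqrt hKk.le]
    rw [← Finset.sum_div, ← Finset.sum_div, div_div, div_le_one (by positivity)]
    exact (sum_cellInfluence_sq_le hg hK.le hzK).trans_eq (by rw [← ht]; ring)
  · have h1 := cellUStatistic_sub_le hg z y
    have h2 : cellUStatistic g y ≤ a := hy
    calc (b - a) / √b / √(K * k) ≤ (t - a) / √t / √(K * k) := by
          gcongr ?_ / _
          exact sub_div_sqrt_mono ha hb hzb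
      _ ≤ (∑ i, cellInfluence g z i * if z i = y i then 0 else 1) / √t / √(K * k) := by
          gcongr
          linarith
      _ = _ := by
          rw [Finset.sum_div, Finset.sum_div]
          exact Finset.sum_congr rfl fun i _ => by ring

/-! ### Comparison of the U-statistic with its discretization -/

lemma consTuple_eq_cons {X : Type*} {m : ℕ} (p : X) (y : Fin m → X) :
    (consTuple p y : Fin (m + 1) → X) = Fin.cons p y := by
  ext i
  refine Fin.cases ?_ (fun i => ?_) i <;> simp [consTuple]

-- Symmetry of the kernel lets the coordinate equal to `p` be swapped into the first place. The sums
-- are matched along an injection covering the support, so no summability is needed.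
open Classical in
lemma tsum_ite_eq_localStatistic {X : Type*} {k : ℕ} {f : (Fin k → X) → ℝ}
    (hf : ∀ (σ : Equiv.Perm (Fin k)) (x : Fin k → X), f (x ∘ σ) = f x) {s : Set X} {p : X}
    (hp : p ∈ s) (j : Fin k) :
    ∑' x : distinctTuples k s, (if x.1 j = p then f x else 0) = localStatistic f p s := by
  obtain _ | m := k
  · exact j.elim0
  have hmem : ∀ y : distinctTuples m (s \ {p}),
      (Fin.cons p y.1 : Fin (m + 1) → X) ∘ Equiv.swap 0 j ∈ distinctTuples (m + 1) s := by
    rintro ⟨y, hy, hys⟩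
    refine ⟨(Fin.cons_injective_iff.2 ⟨?_, hy⟩).comp (Equiv.injective _), fun i => ?_⟩
    · rintro ⟨i, hi⟩
      exact (hys i).2 hi
    · have : ∀ i, (Fin.cons p y : Fin (m + 1) → X) i ∈ s :=
        Fin.cases hp fun i => (hys i).1
      exact this _
  have hinj : Function.Injective fun y : distinctTuples m (s \ {p}) =>
      (⟨_, hmem y⟩ : distinctTuples (m + 1) s) := by
    intro y y' h
    have h' := congrArg (fun x : distinctTuples (m + 1) s => x.1 ∘ Equiv.swap 0 j) h
    simp only [Function.comp_assoc, ← Equiv.coe_trans, Equiv.swap_swap, Equiv.coe_refl,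
      Function.comp_id] at h'
    exact Subtype.ext (Fin.cons_right_injective (α := fun _ => X) p h')
  rw [← hinj.tsum_eq]
  · refine tsum_congr fun y => ?_
    simp only [Function.comp_apply, Equiv.swap_apply_right, Fin.cons_zero, if_true]
    rw [hf, consTuple_eq_cons]
  · intro x hx
    have hxj : x.1 j = p := by
      by_contra h
      exact hx (if_neg h)
    have hx0 : (x.1 ∘ Equiv.swap 0 j) 0 = p := by simp [hxj]
    have hxi : Function.Injective (x.1 ∘ Equiv.swap 0 j) := x.2.1.comp (Equiv.injective _)
    refine ⟨⟨Fin.tail (x.1 ∘ Equiv.swap 0 j), hxi.comp (Fin.succ_injective m),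
      fun i => ⟨x.2.2 _, fun h => ?_⟩⟩, Subtype.ext ?_⟩
    · exact Fin.succ_ne_zero i (hxi (Eq.trans h hx0.symm))
    · change Fin.cons p (Fin.tail (x.1 ∘ Equiv.swap 0 j)) ∘ Equiv.swap 0 j = x.1
      rw [← hx0, Fin.cons_self_tail, Function.comp_assoc, ← Equiv.coe_trans, Equiv.swap_swap,
        Equiv.coe_refl, Function.comp_id]

section Discretization

variable {X : Type*} [MeasurableSpace X] [MeasurableSpace.CountablyGenerated X]

open Classical in
/-- Whether the cell with index `c` contains a point of `s ∩ V`. -/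
noncomputable def occupied (V : Set X) (n : ℕ) (s : Set X) (c : Fin n → Bool) : Bool :=
  decide (s ∩ (V ∩ cell X n ⁻¹' {c})).Nonempty

lemma occupied_eq_true {V : Set X} {n : ℕ} {s : Set X} {c : Fin n → Bool} :
    occupied V n s c = true ↔ ∃ x ∈ s ∩ V, cell X n x = c := by
  simp only [occupied, decide_eq_true_eq, ← Set.inter_assoc]
  rfl

/-- With at most one point per cell, point tuples in `V` correspond to tuples of occupied cells. The
support is thus finite and convergence is automatic. -/
lemma hasSum_cellFunction {k n : ℕ} {V s : Set X} (hinj : Set.InjOn (cell X n) (s ∩ V))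
    (g : (Fin k → Fin n → Bool) → ℝ) :
    HasSum (fun x : distinctTuples k s => cellFunction V n g x)
      (cellUStatistic g (occupied V n s)) := by
  classical
  set p : (Fin k → Fin n → Bool) → Prop := fun c =>
    Function.Injective c ∧ ∀ j, occupied V n s (c j) = true with hp
  have hpt : ∀ c : Subtype p, ∀ j, ∃ x ∈ s ∩ V, cell X n x = c.1 j :=
    fun c j => occupied_eq_true.1 (c.2.2 j)
  choose pt hpt hcell using hpt
  have hcell' : ∀ c, (fun j => cell X n (pt c j)) = c.1 := fun c => funext (hcell c)
  have hmem : ∀ c, pt c ∈ distinctTuples k s := fun c =>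
    ⟨fun i j hij => c.2.1 (by rw [← hcell, ← hcell, hij]), fun j => (hpt c j).1⟩
  have hφ : Function.Injective fun c : Subtype p => (⟨pt c, hmem c⟩ : distinctTuples k s) := by
    intro c d h
    have : pt c = pt d := congrArg Subtype.val h
    exact Subtype.ext (by rw [← hcell' c, ← hcell' d, this])
  rw [← hφ.hasSum_iff]
  · have hval : (fun x : distinctTuples k s => cellFunction V n g x) ∘
        (fun c : Subtype p => (⟨pt c, hmem c⟩ : distinctTuples k s)) = fun c => g c.1 := by
      funext c
      rw [Function.comp_apply, cellFunction, if_pos fun j => (hpt c j).2, hcell']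
    have hU : cellUStatistic g (occupied V n s) = ∑ c : Subtype p, g c := by
      rw [cellUStatistic, ← Finset.sum_subtype (Finset.univ.filter p)
        (fun c => by rw [Finset.mem_filter]; exact and_iff_right (Finset.mem_univ c)) g,
        Finset.sum_filter]
      exact Finset.sum_congr rfl fun c _ => by congr
    rw [hval, hU]
    exact hasSum_fintype _
  · intro x hx
    by_contra hne
    have hV : ∀ j, x.1 j ∈ V := by
      by_contra h
      exact hne (if_neg h)
    have hc : p fun j => cell X n (x.1 j) :=
      ⟨fun i j hij => x.2.1 (hinj ⟨x.2.2 i, hV i⟩ ⟨x.2.2 j, hV j⟩ hij),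
        fun j => occupied_eq_true.2 ⟨x.1 j, ⟨x.2.2 j, hV j⟩, rfl⟩⟩
    refine hx ⟨⟨_, hc⟩, Subtype.ext (funext fun j => ?_)⟩
    exact hinj (hpt _ j) ⟨x.2.2 j, hV j⟩ (hcell ⟨_, hc⟩ j)

lemma abs_uStatistic_sub_cellUStatistic_le {k n : ℕ} {V s : Set X}
    (hinj : Set.InjOn (cell X n) (s ∩ V)) {g : (Fin k → Fin n → Bool) → ℝ}
    {f : (Fin k → X) → ℝ} (hf : Summable fun x : distinctTuples k s => f x) {δ : ℝ}
    (hsum : Summable fun x : distinctTuples k s => |f x - cellFunction V n g x|)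
    (hδ : ∑' x : distinctTuples k s, |f x - cellFunction V n g x| ≤ δ) :
    |uStatistic f s - cellUStatistic g (occupied V n s)| ≤ δ := by
  have h := hf.hasSum.sub (hasSum_cellFunction hinj g)
  rw [uStatistic, ← h.tsum_eq]
  exact (norm_tsum_le_tsum_norm (f := fun x : distinctTuples k s => f x - cellFunction V n g x)
    hsum).trans hδ

/-- An occupied cell holds a single point `p`, which may sit in any of `k` positions, each
contributing the local statistic at `p`. This is the second factor `k` in the final exponent. -/
lemma cellInfluence_le {k n : ℕ} {V s : Set X}
    (hinj : Set.InjOn (cell X n) (s ∩ V)) {g : (Fin k → Fin n → Bool) → ℝ}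
    {f : (Fin k → X) → ℝ} (hf0 : ∀ x, 0 ≤ f x)
    (hsymm : ∀ (σ : Equiv.Perm (Fin k)) (x : Fin k → X), f (x ∘ σ) = f x)
    (hf : Summable fun x : distinctTuples k s => f x) {δ B : ℝ} (hδ0 : 0 ≤ δ) (hB0 : 0 ≤ B)
    (hsum : Summable fun x : distinctTuples k s => |f x - cellFunction V n g x|)
    (hδ : ∑' x : distinctTuples k s, |f x - cellFunction V n g x| ≤ δ)
    (hB : ∀ x ∈ s, localStatistic f x s ≤ B) (i : Fin n → Bool) :
    cellInfluence g (occupied V n s) i ≤ k * B + δ := by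
  classical
  by_cases hi : occupied V n s i = true
  · obtain ⟨p, hp, rfl⟩ := occupied_eq_true.1 hi
    set G : (Fin k → Fin n → Bool) → ℝ := Set.indicator {c | ∃ j, c j = cell X n p} g with hG
    have hs := hasSum_cellFunction hinj G
    have hsj : ∀ j : Fin k, Summable fun x : distinctTuples k s =>
        if x.1 j = p then f x else 0 := fun j =>
      hf.of_nonneg_of_le (fun x => by have := hf0 x; split_ifs <;> simp [this])
        fun x => by have := hf0 x; split_ifs <;> simp [this]
    have hs' := (summable_sum (s := Finset.univ) fun j _ => hsj j).add hsum
    have hle : ∀ x : distinctTuples k s,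
        cellFunction V n G x ≤
          ∑ j, (if x.1 j = p then f x else 0) + |f x - cellFunction V n g x| := by
      intro x
      have hterm : ∀ j ∈ Finset.univ, 0 ≤ if x.1 j = p then f x else 0 := fun j _ => by
        have := hf0 x
        split_ifs <;> simp [this]
      have h0 := add_nonneg (Finset.sum_nonneg hterm) (abs_nonneg (f x - cellFunction V n g x))
      by_cases hV : ∀ j, x.1 j ∈ V
      · by_cases hj : ∃ j, cell X n (x.1 j) = cell X n p
        · rw [cellFunction, cellFunction, if_pos hV, if_pos hV, hG,
            Set.indicator_of_mem (s := {c : Fin k → Fin n → Bool | ∃ j, c j = cell X n p}) hj]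
          obtain ⟨j, hj⟩ := hj
          have hxp : x.1 j = p := hinj ⟨x.2.2 j, hV j⟩ hp hj
          have h1 := Finset.single_le_sum hterm (Finset.mem_univ j)
          rw [if_pos hxp] at h1
          have h2 := neg_abs_le (f x - g fun j => cell X n (x.1 j))
          linarith
        · rw [cellFunction, if_pos hV, hG,
            Set.indicator_of_notMem (s := {c : Fin k → Fin n → Bool | ∃ j, c j = cell X n p}) hj]
          exact h0
      · rw [cellFunction, if_neg hV]
        exact h0
    rw [cellInfluence, ← hs.tsum_eq]
    calc _ ≤ _ := hs.summable.tsum_le_tsum hle hs'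
      _ = ∑ j : Fin k, localStatistic f p s +
          ∑' x : distinctTuples k s, |f x - cellFunction V n g x| := by
          rw [(summable_sum (s := Finset.univ) fun j _ => hsj j).tsum_add hsum,
            Summable.tsum_finsetSum fun j _ => hsj j]
          congr 1
          exact Finset.sum_congr rfl fun j _ => tsum_ite_eq_localStatistic hsymm hp.1 j
      _ ≤ _ := by
          rw [Finset.sum_const, Finset.card_univ, Fintype.card_fin, nsmul_eq_mul]
          have := hB p hp.1
          gcongr
  · have : cellInfluence g (occupied V n s) i = 0 := by
      refine Finset.sum_eq_zero fun c _ => ?_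
      split_ifs with h
      · refine Set.indicator_of_notMem ?_ _
        rintro ⟨j, rfl⟩
        exact hi (h.2 j)
      · rfl
    rw [this]
    positivity

end Discretization

/-! ### Concentration for Poisson U-statistics -/

namespace IsPoissonProcess

section Occupied

variable {X Ω : Type*} [TopologicalSpace X] [MeasurableSpace X]
  [MeasurableSpace.CountablyGenerated X] {μ : Measure X}
  [MeasurableSpace Ω] {P : Measure Ω} {η : Ω → PointConfig X}

lemma _root_.occupied_points_eq (V : Set X) (n : ℕ) (ξ : PointConfig X) (c : Fin n → Bool) :
    occupied V n ξ.points c = decide (PointConfig.count (V ∩ cell X n ⁻¹' {c}) ξ ≠ 0) := by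
  classical
  rw [Bool.eq_iff_iff, occupied, decide_eq_true_iff, decide_eq_true_iff, PointConfig.count,
    Set.encard_ne_zero]

variable (hη : IsPoissonProcess η μ P)

include hη

lemma measurable_occupied {V : Set X} (hV : MeasurableSet V) (n : ℕ) (c : Fin n → Bool) :
    Measurable fun ω => occupied V n (η ω).points c := by
  simp_rw [occupied_points_eq]
  exact (Measurable.of_discrete (f := fun m : ℕ∞ => decide (m ≠ 0))).comp
    (hη.measurable_count (hV.inter (measurableSet_cell_fiber n c)))

lemma iIndepFun_occupied {V : Set X} (hV : MeasurableSet V) (n : ℕ) :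
    iIndepFun (fun (c : Fin n → Bool) ω => occupied V n (η ω).points c) P := by
  set e := Fintype.equivFin (Fin n → Bool)
  have h := (hη.indep_count _ (fun i => V ∩ cell X n ⁻¹' {e.symm i})
    (fun i => hV.inter (measurableSet_cell_fiber n _)) fun i j hij =>
      Set.disjoint_left.2 fun x hx hy => hij (e.symm.injective
        ((hx.2 : cell X n x = _).symm.trans hy.2))).comp
    (fun _ m => decide (m ≠ 0)) fun _ => .of_discrete
  have h' := h.precomp (g := e) e.injective
  simp_rw [occupied_points_eq]
  simpa [Function.comp_def] using h'

lemma measurableSet_injOn_cell {V : Set X} (hV : MeasurableSet V) (n : ℕ) :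
    MeasurableSet {ω | ¬ Set.InjOn (cell X n) ((η ω).points ∩ V)} := by
  have : {ω | ¬ Set.InjOn (cell X n) ((η ω).points ∩ V)} =
      ⋃ c, {ω | 1 < PointConfig.count (V ∩ cell X n ⁻¹' {c}) (η ω)} := by
    ext ω
    simp only [Set.mem_ofPred_eq, Set.mem_iUnion, PointConfig.count, Set.one_lt_encard_iff,
      Set.InjOn]
    push Not
    constructor
    · rintro ⟨x, hx, y, hy, hxy, hne⟩
      exact ⟨cell X n y, x, y, ⟨hx.1, hx.2, hxy⟩, ⟨hy.1, hy.2, rfl⟩, hne⟩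
    · rintro ⟨c, x, y, hx, hy, hne⟩
      exact ⟨x, ⟨hx.1, hx.2.1⟩, y, ⟨hy.1, hy.2.1⟩,
        (hx.2.2 : cell X n x = c).trans (hy.2.2 : cell X n y = c).symm, hne⟩
  rw [this]
  exact MeasurableSet.iUnion fun c =>
    hη.measurable_count (hV.inter (measurableSet_cell_fiber n c))
      (t := {m : ℕ∞ | 1 < m}) .of_discrete

/-- The events decrease in `n`, and almost surely `V` holds finitely many points, which are
eventually separated. -/
lemma tendsto_measure_not_injOn_cell [IsFiniteMeasure P] [MeasurableSpace.SeparatesPoints X]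
    {V : Set X} (hV : MeasurableSet V) (hfin : μ V < ⊤) :
    Filter.Tendsto (fun n => P {ω | ¬ Set.InjOn (cell X n) ((η ω).points ∩ V)}) Filter.atTop
      (𝓝 0) := by
  have h := tendsto_measure_iInter_atTop (μ := P)
    (fun n => (hη.measurableSet_injOn_cell hV n).nullMeasurableSet)
    (fun m n hmn ω hω hinj => hω fun x hx y hy hxy => hinj hx hy (cell_eq_of_le hmn hxy))
    ⟨0, measure_ne_top _ _⟩
  suffices h0 : P (⋂ n, {ω | ¬ Set.InjOn (cell X n) ((η ω).points ∩ V)}) = 0 by rwa [h0] at h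
  refine measure_eq_zero_iff_ae_notMem.2 ?_
  filter_upwards [hη.ae_count_lt_top hV hfin] with ω hω hmem
  obtain ⟨n, hn⟩ := exists_injOn_cell (Set.encard_lt_top_iff.1 hω)
  exact Set.mem_iInter.1 hmem n (hn n le_rfl)

end Occupied

variable {X Ω : Type*} [TopologicalSpace X] [PolishSpace X] [MeasurableSpace X] [BorelSpace X]
  {μ : Measure X} [SigmaFinite μ] [MeasurableSpace Ω] {P : Measure Ω} {η : Ω → PointConfig X}
  (hη : IsPoissonProcess η μ P) {k : ℕ} {f : (Fin k → X) → ℝ}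

include hη

/-- The sum defining a U-statistic with integrable nonnegative kernel converges almost surely. -/
theorem ae_summable (hf : Measurable f) (hf0 : ∀ x, 0 ≤ f x)
    (hfi : Integrable f (Measure.pi fun _ : Fin k => μ)) :
    ∀ᵐ ω ∂P, Summable fun x : distinctTuples k (η ω).points => f x := by
  have h := hη.lintegral_lintegral_tupleMeasure_le (k := k) hf.ennreal_ofReal
  have hlt : ∫⁻ ω, ∫⁻ x, ENNReal.ofReal (f x) ∂tupleMeasure k (η ω).points ∂P < ⊤ :=
    h.2.trans_lt hfi.lintegral_lt_top
  filter_upwards [ae_lt_top' h.1 hlt.ne] with ω hω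
  rw [lintegral_tupleMeasure (η ω).countable_points] at hω
  have := ENNReal.summable_toReal hω.ne
  simpa [ENNReal.toReal_ofReal (hf0 _)] using this

/-- Up to an event of small probability, a Poisson U-statistic and its local versions are close to
those of independent Boolean variables. -/
lemma exists_discretization [IsProbabilityMeasure P] (hf : Measurable f) (hf0 : ∀ x, 0 ≤ f x)
    (hsymm : ∀ (σ : Equiv.Perm (Fin k)) (x : Fin k → X), f (x ∘ σ) = f x)
    (hfi : Integrable f (Measure.pi fun _ : Fin k => μ)) {B : ℝ} (hB : 0 ≤ B) {δ : ℝ}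
    (hδ : 0 < δ) :
    ∃ (n : ℕ) (Z : (Fin n → Bool) → Ω → Bool) (g : (Fin k → Fin n → Bool) → ℝ) (E : Set Ω),
      (∀ i, Measurable (Z i)) ∧ iIndepFun Z P ∧ (∀ c, 0 ≤ g c) ∧ P.real E ≤ 2 * δ ∧
      ∀ ω, ω ∉ E →
        |uStatistic f (η ω).points - cellUStatistic g (fun i => Z i ω)| ≤ δ ∧
        ((∀ x ∈ (η ω).points, localStatistic f x (η ω).points ≤ B) →
          ∀ i, cellInfluence g (fun i => Z i ω) i ≤ k * B + δ) := by
  -- An expected error `δ²` exceeds `δ` with probability at most `δ`, by Markov.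
  have hδ2 : 0 < ENNReal.ofReal (δ * δ) := ENNReal.ofReal_pos.2 (mul_pos hδ hδ)
  obtain ⟨N, n₀, happrox⟩ := exists_cellFunction_approx hf hf0 hfi hδ2
  set V := spanningSets μ N
  have hVm : MeasurableSet V := measurableSet_spanningSets μ N
  obtain ⟨n, hD, hn⟩ := (((hη.tendsto_measure_not_injOn_cell hVm
    (measure_spanningSets_lt_top μ N)).eventually_lt_const (ENNReal.ofReal_pos.2 hδ)).and
    (Filter.eventually_ge_atTop n₀)).exists
  obtain ⟨g, hg, hgδ⟩ := happrox n hn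
  set D₁ := {ω | ¬ Set.InjOn (cell X n) ((η ω).points ∩ V)} with hD₁
  set D₂ := {ω | ENNReal.ofReal δ ≤
    ∫⁻ x, ‖f x - cellFunction V n g x‖ₑ ∂tupleMeasure k (η ω).points} with hD₂
  set D₃ := {ω | ¬ Summable fun x : distinctTuples k (η ω).points => f x} with hD₃
  have hPD₁ : P.real D₁ ≤ δ := ENNReal.toReal_le_of_le_ofReal hδ.le hD.le
  have hPD₂ : P.real D₂ ≤ δ := by
    have h := hη.lintegral_lintegral_tupleMeasure_le (k := k)
      (hf.sub (measurable_cellFunction hVm n g)).enorm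
    have hM := (mul_meas_ge_le_lintegral₀ h.1 (ENNReal.ofReal δ)).trans (h.2.trans hgδ)
    rw [ENNReal.ofReal_mul hδ.le] at hM
    refine ENNReal.toReal_le_of_le_ofReal hδ.le ?_
    exact (ENNReal.mul_le_mul_iff_right (ENNReal.ofReal_pos.2 hδ).ne' ENNReal.ofReal_ne_top).1 hM
  have hPD₃ : P.real D₃ = 0 := by
    rw [measureReal_def, show P D₃ = 0 from hη.ae_summable hf hf0 hfi, ENNReal.toReal_zero]
  refine ⟨n, fun c ω => occupied V n (η ω).points c, g, D₁ ∪ D₂ ∪ D₃,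
    hη.measurable_occupied hVm n, hη.iIndepFun_occupied hVm n, hg, ?_, fun ω hω => ?_⟩
  · have h1 := measureReal_union_le (μ := P) (D₁ ∪ D₂) D₃
    have h2 := measureReal_union_le (μ := P) D₁ D₂
    linarith
  · simp only [Set.mem_union, not_or] at hω
    obtain ⟨⟨h1, h2⟩, h3⟩ := hω
    have hinj : Set.InjOn (cell X n) ((η ω).points ∩ V) := not_not.1 h1
    have hsumm : Summable fun x : distinctTuples k (η ω).points => f x := not_not.1 h3
    have h2 : ∑' x : distinctTuples k (η ω).points, ‖f x - cellFunction V n g x‖ₑ <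
        ENNReal.ofReal δ := by
      rw [← lintegral_tupleMeasure (η ω).countable_points
        fun x => ‖f x - cellFunction V n g x‖ₑ]
      exact not_le.1 h2
    have hne := (h2.trans ENNReal.ofReal_lt_top).ne
    have hsum : Summable fun x : distinctTuples k (η ω).points =>
        |f x - cellFunction V n g x| := by
      simpa using ENNReal.summable_toReal hne
    have hle : ∑' x : distinctTuples k (η ω).points, |f x - cellFunction V n g x| ≤ δ := by
      have := ENNReal.toReal_le_of_le_ofReal hδ.le h2.le
      rw [ENNReal.tsum_toReal_eq fun x => enorm_ne_top] at this
      simpa using this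
    exact ⟨abs_uStatistic_sub_cellUStatistic_le hinj hsumm hsum hle, fun hloc i =>
      cellInfluence_le hinj hf0 hsymm hsumm hδ.le hB hsum hle hloc i⟩

/-- The two-set concentration bound for Poisson U-statistics. -/
theorem uStatistic_concentration [IsProbabilityMeasure P] (hk : 0 < k) (hf : Measurable f)
    (hf0 : ∀ x, 0 ≤ f x)
    (hsymm : ∀ (σ : Equiv.Perm (Fin k)) (x : Fin k → X), f (x ∘ σ) = f x)
    (hfi : Integrable f (Measure.pi fun _ : Fin k => μ)) {a b B : ℝ} (ha : 0 ≤ a) (hab : a < b)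
    (hB : 0 < B) :
    P.real {ω | uStatistic f (η ω).points ≤ a} *
      P.real {ω | b ≤ uStatistic f (η ω).points ∧
        ∀ x ∈ (η ω).points, localStatistic f x (η ω).points ≤ B} ≤
      Real.exp (-((b - a) ^ 2 / (4 * (k : ℝ) ^ 2 * B * b))) := by
  have hk' : (0 : ℝ) < k := Nat.cast_pos.2 hk
  have hb : 0 < b := ha.trans_lt hab
  set A := {ω | uStatistic f (η ω).points ≤ a}
  set S := {ω | b ≤ uStatistic f (η ω).points ∧
    ∀ x ∈ (η ω).points, localStatistic f x (η ω).points ≤ B}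
  -- The levels shift by `δ` and each probability by `2 * δ`; the upper bound on `δ` keeps the
  -- shifted levels ordered. Then `δ` tends to zero.
  have hbound : ∀ δ : ℝ, 0 < δ → δ < (b - a) / 2 → P.real A * P.real S ≤
      Real.exp (-(((b - δ) - (a + δ)) ^ 2 / (4 * ((k * B + δ) * k * (b - δ))))) +
        (4 * δ + 4 * δ ^ 2) := by
    intro δ hδ hδab
    obtain ⟨n, Z, g, E, hZ, hind, hg, hE, hωE⟩ :=
      hη.exists_discretization hf hf0 hsymm hfi hB.le hδ
    have hconc := cellUStatistic_concentration hk hg hZ hind (a := a + δ) (b := b - δ)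
      (K := k * B + δ) (by linarith) (by linarith) (by positivity)
    set A' := {ω | cellUStatistic g (fun i => Z i ω) ≤ a + δ}
    set S' := {ω | b - δ ≤ cellUStatistic g (fun i => Z i ω) ∧
        ∀ i, cellInfluence g (fun i => Z i ω) i ≤ k * B + δ}
    have hA : P.real A ≤ P.real A' + 2 * δ := by
      have hsub : A ⊆ A' ∪ E := by
        intro ω hω
        by_cases hmem : ω ∈ E
        · exact Or.inr hmem
        · left
          have h1 := abs_le.1 (hωE ω hmem).1
          have h2 : uStatistic f (η ω).points ≤ a := hω
          change cellUStatistic g (fun i => Z i ω) ≤ a + δ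
          linarith
      exact (measureReal_mono hsub).trans ((measureReal_union_le _ _).trans (by gcongr))
    have hS : P.real S ≤ P.real S' + 2 * δ := by
      have hsub : S ⊆ S' ∪ E := by
        intro ω hω
        by_cases hmem : ω ∈ E
        · exact Or.inr hmem
        · left
          have h1 := abs_le.1 (hωE ω hmem).1
          refine ⟨?_, (hωE ω hmem).2 hω.2⟩
          have := hω.1
          linarith
      exact (measureReal_mono hsub).trans ((measureReal_union_le _ _).trans (by gcongr))
    have hA1 : P.real A' ≤ 1 := measureReal_le_one
    have hS1 : P.real S' ≤ 1 := measureReal_le_one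
    calc P.real A * P.real S ≤ (P.real A' + 2 * δ) * (P.real S' + 2 * δ) := by
          gcongr
      _ ≤ P.real A' * P.real S' + (4 * δ + 4 * δ ^ 2) := by nlinarith
      _ ≤ _ := by gcongr
  have hcont : ContinuousAt (fun δ : ℝ =>
      Real.exp (-(((b - δ) - (a + δ)) ^ 2 / (4 * ((k * B + δ) * k * (b - δ))))) +
        (4 * δ + 4 * δ ^ 2)) 0 := by
    have : (4 * ((k * B + 0) * k * (b - 0)) : ℝ) ≠ 0 := by
      rw [add_zero, sub_zero]
      positivity
    fun_prop (disch := assumption)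
  have hlim := hcont.tendsto.mono_left (nhdsWithin_le_nhds (s := Set.Ioi 0))
  have h0 : (4 * (k * B * k * b) : ℝ) = 4 * (k : ℝ) ^ 2 * B * b := by ring
  simp only [sub_zero, add_zero, mul_zero, ne_eq, OfNat.ofNat_ne_zero, not_false_eq_true,
    zero_pow, h0] at hlim
  refine ge_of_tendsto hlim ?_
  filter_upwards [Ioo_mem_nhdsGT (show (0 : ℝ) < (b - a) / 2 by linarith)] with δ hδ
  exact hbound δ hδ.1 hδ.2

end IsPoissonProcess

/-! ### From the two-set bound to deviations from the median -/

lemma uStatistic_nonneg {X : Type*} {k : ℕ} {f : (Fin k → X) → ℝ} (hf0 : ∀ x, 0 ≤ f x)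
    (s : Set X) : 0 ≤ uStatistic f s :=
  tsum_nonneg fun x => hf0 x

theorem mainTheorem2
    {X : Type*} [TopologicalSpace X] [PolishSpace X] [MeasurableSpace X] [BorelSpace X]
    (μ : Measure X) [IsLocallyFiniteMeasure μ] [NullSingletonClass μ]
    {Ω : Type*} [MeasurableSpace Ω] (P : Measure Ω) [IsProbabilityMeasure P]
    (η : Ω → PointConfig X) (hη : IsPoissonProcess η μ P)
    (k : ℕ) (hk : 1 ≤ k)
    (f : (Fin k → X) → ℝ) (hf_meas : Measurable f)
    (hf_symm : ∀ (σ : Equiv.Perm (Fin k)) (x : Fin k → X), f (x ∘ σ) = f x)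
    (hf_nonneg : ∀ x, 0 ≤ f x)
    (hf_int : Integrable f (Measure.pi fun _ : Fin k => μ))
    (ε : ℝ → ℝ) (B : ℝ)
    (hε : P.real {ω | ∃ x ∈ (η ω).points, B < localStatistic f x (η ω).points} ≤ ε B)
    (m : ℝ) (hm : IsMedian (fun ω => uStatistic f (η ω).points) P m) :
    (∀ᵐ ω ∂P, Summable fun x : distinctTuples k (η ω).points => f x) ∧
    ∀ u : ℝ, 0 ≤ u →
      P.real {ω | u ≤ |uStatistic f (η ω).points - m|} ≤
        4 * Real.exp (-(u ^ 2 / (4 * (k : ℝ) ^ 2 * B * (u + m)))) + 3 * ε B := by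
  refine ⟨hη.ae_summable hf_meas hf_nonneg hf_int, fun u hu => ?_⟩
  set U : Ω → ℝ := fun ω => uStatistic f (η ω).points with hU
  have hU0 : ∀ ω, 0 ≤ U ω := fun ω => uStatistic_nonneg hf_nonneg _
  have hε0 : 0 ≤ ε B := measureReal_nonneg.trans hε
  have hm0 : 0 ≤ m := by
    by_contra! hneg
    have hempty : {ω | U ω ≤ m} = ∅ :=
      Set.eq_empty_iff_forall_notMem.2 fun ω hω => absurd (hneg.trans_le (hU0 ω)) (not_lt.2 hω)
    have := hm.1
    rw [hempty, measureReal_empty] at this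
    norm_num at this
  -- A nonpositive fraction, including the value `0` for a vanishing denominator, makes the right
  -- side at least `4`.
  have htriv : u ^ 2 / (4 * (k : ℝ) ^ 2 * B * (u + m)) ≤ 0 →
      P.real {ω | u ≤ |U ω - m|} ≤
        4 * Real.exp (-(u ^ 2 / (4 * (k : ℝ) ^ 2 * B * (u + m)))) + 3 * ε B := by
    intro h
    have h1 : P.real {ω | u ≤ |U ω - m|} ≤ 1 := measureReal_le_one
    have h2 := Real.one_le_exp (neg_nonneg.2 h)
    linarith
  rcases hu.eq_or_lt with rfl | hu
  · exact htriv (by simp)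
  rcases le_or_gt B 0 with hB | hB
  · refine htriv (div_nonpos_of_nonneg_of_nonpos (sq_nonneg u) ?_)
    have h4 : (0 : ℝ) ≤ 4 * (k : ℝ) ^ 2 := by positivity
    exact mul_nonpos_of_nonpos_of_nonneg (mul_nonpos_of_nonneg_of_nonpos h4 hB) (by linarith)
  have hk' : (0 : ℝ) < k := Nat.cast_pos.2 hk
  have hconc : ∀ {a b : ℝ}, 0 ≤ a → a < b → P.real {ω | U ω ≤ a} * P.real {ω | b ≤ U ω ∧
      ∀ x ∈ (η ω).points, localStatistic f x (η ω).points ≤ B} ≤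
      Real.exp (-((b - a) ^ 2 / (4 * (k : ℝ) ^ 2 * B * b))) := fun ha hab =>
    hη.uStatistic_concentration hk hf_meas hf_nonneg hf_symm hf_int ha hab hB
  have hlocal : ∀ b, P.real {ω | b ≤ U ω} ≤ P.real {ω | b ≤ U ω ∧
      ∀ x ∈ (η ω).points, localStatistic f x (η ω).points ≤ B} + ε B := by
    intro b
    refine (measureReal_mono fun ω hω => ?_).trans ((measureReal_union_le _ _).trans
      (add_le_add_right hε _))
    by_cases h : ∀ x ∈ (η ω).points, localStatistic f x (η ω).points ≤ B
    · exact Or.inl ⟨hω, h⟩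
    · push Not at h
      exact Or.inr h
  set e := Real.exp (-(u ^ 2 / (4 * (k : ℝ) ^ 2 * B * (u + m)))) with he
  have he0 : 0 < e := Real.exp_pos _
  have hupper : P.real {ω | m + u ≤ U ω} ≤ 2 * e + ε B := by
    have h1 := hconc hm0 (show m < m + u by linarith)
    rw [add_sub_cancel_left, add_comm m u] at h1
    have h2 := hlocal (u + m)
    rw [add_comm m u]
    have h3 : 1 / 2 ≤ P.real {ω | U ω ≤ m} := hm.1
    have h4 : 0 ≤ P.real {ω | u + m ≤ U ω ∧
      ∀ x ∈ (η ω).points, localStatistic f x (η ω).points ≤ B} := measureReal_nonneg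
    nlinarith
  -- Here the local condition is imposed at the level `m`, so the other factor is only at least `1 /
  -- 2 - ε B`; moving the `ε B` term across and doubling costs `2 * ε B`.
  have hlower : P.real {ω | U ω ≤ m - u} ≤ 2 * e + 2 * ε B := by
    rcases lt_or_ge (m - u) 0 with hneg | hmu
    · have hempty : {ω | U ω ≤ m - u} = ∅ :=
        Set.eq_empty_iff_forall_notMem.2 fun ω hω => absurd (hneg.trans_le (hU0 ω)) (not_lt.2 hω)
      rw [hempty, measureReal_empty]
      positivity
    · have h1 := hconc hmu (show m - u < m by linarith)
      rw [sub_sub_cancel] at h1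
      have hmpos : 0 < m := by linarith
      have h1' : Real.exp (-(u ^ 2 / (4 * (k : ℝ) ^ 2 * B * m))) ≤ e := by
        rw [he, Real.exp_le_exp, neg_le_neg_iff]
        gcongr
        linarith
      have h2 := hlocal m
      have h3 : 1 / 2 ≤ P.real {ω | m ≤ U ω} := hm.2
      have h4 : 0 ≤ P.real {ω | U ω ≤ m - u} := measureReal_nonneg
      have h5 : P.real {ω | U ω ≤ m - u} ≤ 1 := measureReal_le_one
      nlinarith
  have hsub : {ω | u ≤ |U ω - m|} ⊆ {ω | m + u ≤ U ω} ∪ {ω | U ω ≤ m - u} := by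
    intro ω hω
    rcases le_abs.1 (show u ≤ |U ω - m| from hω) with h | h
    · left
      change m + u ≤ U ω
      linarith
    · right
      change U ω ≤ m - u
      linarith
  have := (measureReal_mono (μ := P) hsub).trans (measureReal_union_le _ _)
  linarith
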